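/- Let $n\ge 2$ and $m=2n$. Let $\mathbb C_{m}$ be the complex Clifford algebra generated by $e_1,\dots,e_{m}$ with $e_ie_j+e_je_i=-2\delta_{ij}$, and let $S\subset\mathbb C_{m}$ be a subspace which is invariant under left multiplication by $Spin(m)$ and is a basic spinor representation of $Spin(m)$, i.e. is equivalent to one of the two half-spinor modules $S^{\pm}_{2n}=\{u\in S_{2n}:\theta u=\pm u\}$, where $S_{2n}$ is an irreducible left $\mathbb C_{2n}$-module and $\theta=(-i)^ne_1e_2\cdots e_{2n}$. For $d\in\{2n-1,2n\}$ and $j\ge 0$ let $\mathcal M_j(\mathbb R^{d},S)$ be the space of $S$-valued $j$-homogeneous polynomials $P$ on $\mathbb R^{d}$ with $\sum_{i=1}^{d}e_i\,\partial P/\partial x_i=0$. It is an $\mathfrak{so}(d)$-module, where the bivector $\tfrac12e_ie_j$ acts by $\tfrac12e_ie_j+x_j\partial_{x_i}-x_i\partial_{x_j}$, and $\mathfrak{so}(r)$ denotes the span of the bivectors $e_ie_j$, $1\le i<j\le r$. A Gelfand–Tsetlin (GT) basis of an irreducible $\mathfrak{so}(d)$-module $V$ is a basis of $V$, orthogonal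 with respect to every invariant inner product on $V$, which consists of one nonzero vector from each of the one-dimensional $\mathfrak{so}(2)$-modules obtained from $V$ by restricting successively along $\mathfrak{so}(d)\supset\mathfrak{so}(d-1)\supset\cdots\supset\mathfrak{so}(2)$ and decomposing at each step into a multiplicity free direct sum of irreducible submodules. Let $k\ge 0$ and let $\mathcal B^{2n-1}_j(S)$ be GT bases of the modules $\mathcal M_j(\mathbb R^{2n-1},S)$ for all $j=0,\dots,k$. Then the set $$\mathcal B^{2n}_k(S)=\bigcup_{j=0}^k\{X^{(j)}_{k-j}\,p : p\in\mathcal B^{2n-1}_{k-j}(S)\}$$ is a GT basis of the module $\mathcal M_k(\mathbb R^{2n},S)$. Here polynomials in $\underline x=x_1e_1+\cdots+x_{m-1}e_{m-1}$ are regarded as polynomials in $(x_1,\dots,x_m)$, $X^{(0)}_l=1$ and, for $j\ge1$, $l\ge 0$, $$X^{(j)}_l=\mu^j_l\,r^j\Big(C_j^{m/2+l-1}\big(\tfrac{x_m}{r}\big)+\tfrac{m+2l-2}{m+2l+j-2}\,C_{j-1}^{m/2+l}\big(\tfrac{x_m}{r}\big)\tfrac{\underline x e_m}{r}\Big),$$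 where $r=(x_1^2+\cdots+x_m^2)^{1/2}$, $C^\nu_j$ are the Gegenbauer polynomials, $\mu^{2s}_l=(-1)^s\big(C_{2s}^{m/2+l-1}(0)\big)^{-1}$ and $\mu^{2s+1}_l=(-1)^s\frac{m+2l+2s-1}{m+2l-2}\big(C_{2s}^{m/2+l}(0)\big)^{-1}$. -/

import Mathlib

open scoped TensorProduct

/-! Complex Clifford algebra, the group `Spin(m)`, basic spinor representations -/

/-- The quadratic form `v ↦ -(v₁² + ⋯ + vₘ²)` on `ℂᵐ`. -/
noncomputable abbrev negSq (m : ℕ) : QuadraticForm ℂ (Fin m → ℂ) :=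
  QuadraticMap.weightedSumSquares ℂ (fun _ : Fin m => (-1 : ℂ))

/-- The complex Clifford algebra `ℂ_m`, with `e_j ^ 2 = -1`. -/
abbrev Cl (m : ℕ) : Type := CliffordAlgebra (negSq m)

/-- The generators `e_1, …, e_m` of `ℂ_m` (indexed from `0`). -/
noncomputable def gen {m : ℕ} (i : Fin m) : Cl m :=
  CliffordAlgebra.ι (negSq m) (Pi.single i 1)

/-- A real vector `x = ∑ x_i e_i` as an element of `ℂ_m`. -/
noncomputable def realVec {m : ℕ} (x : Fin m → ℝ) : Cl m := ∑ i, (x i : ℂ) • gen i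

/-- `Spin(m)`: the products of an even number of unit vectors of `ℝᵐ`. -/
noncomputable def spin (m : ℕ) : Submonoid (Cl m) :=
  Submonoid.closure {s | ∃ v w : Fin m → ℝ,
    ∑ i, v i ^ 2 = 1 ∧ ∑ i, w i ^ 2 = 1 ∧ s = realVec v * realVec w}

/-- `θ_m = (-i)^n e_1 e_2 ⋯ e_m` for `m = 2 n`. -/
noncomputable def theta (m : ℕ) : Cl m :=
  ((-Complex.I) ^ (m / 2)) • (List.ofFn (fun i : Fin m => gen i)).prod

/-- For a left ideal `J` of `ℂ_m`, the subspace `{u ∈ J : θ_m u = ε u}`. -/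
noncomputable def halfSpinor {m : ℕ} (J : Submodule (Cl m) (Cl m)) (ε : ℂ) :
    Submodule ℂ (Cl m) :=
  J.restrictScalars ℂ ⊓
    LinearMap.ker (LinearMap.mulLeft ℂ (theta m) - ε • LinearMap.id)

/-- Let `m` be even. A subspace `S` of `ℂ_m` which is invariant under left multiplication by
`Spin(m)` is a basic spinor representation if it is equivalent, as a `Spin(m)`-module, to `S⁺` or
`S⁻`, the two halves of an irreducible `ℂ_m`-module (realised as a minimal left ideal `J`). -/
def IsBasicSpinor {m : ℕ} (S : Submodule ℂ (Cl m)) : Prop :=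
  (∀ s ∈ spin m, ∀ u ∈ S, s * u ∈ S) ∧
  ∃ J : Submodule (Cl m) (Cl m), IsSimpleModule (Cl m) J ∧
    ∃ ε : ℂ, (ε = 1 ∨ ε = -1) ∧
      ∃ φ : S ≃ₗ[ℂ] halfSpinor J ε, ∀ s ∈ spin m, ∀ u v : S,
        (v : Cl m) = s * (u : Cl m) → (φ v : Cl m) = s * (φ u : Cl m)

/-! Gelfand–Tsetlin bases.

`T i j` is the operator by which the bivector `e_i e_j` (up to a fixed nonzero scalar) acts on the
complex vector space `M`; `so(r)` is spanned by the bivectors with `i < j` among the first `r`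
indices. -/

section GT

variable {m : ℕ} {M : Type*} [AddCommGroup M] [Module ℂ M]

/-- `W` is an `so(r)`-submodule. -/
def IsSoInvariant (T : Fin m → Fin m → Module.End ℂ M) (r : ℕ) (W : Submodule ℂ M) : Prop :=
  ∀ i j : Fin m, i < j → j.val < r → ∀ w ∈ W, T i j w ∈ W

/-- `W` is an irreducible `so(r)`-submodule. -/
def IsSoIrreducible (T : Fin m → Fin m → Module.End ℂ M) (r : ℕ) (W : Submodule ℂ M) : Prop :=
  IsSoInvariant T r W ∧ W ≠ ⊥ ∧
    ∀ U : Submodule ℂ M, U ≤ W → IsSoInvariant T r U → U = ⊥ ∨ U = W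

/-- The `so(r)`-submodules `W` and `W'` are equivalent. -/
def SoEquivalent (T : Fin m → Fin m → Module.End ℂ M) (r : ℕ) (W W' : Submodule ℂ M) : Prop :=
  ∃ φ : W ≃ₗ[ℂ] W', ∀ i j : Fin m, i < j → j.val < r → ∀ u v : W,
    (v : M) = T i j (u : M) → (φ v : M) = T i j (φ u : M)

/-- `E` consists of one nonzero vector from each of the `so(2)`-modules into which the irreducible
`so(r)`-module `V` is split by restricting successively along `so(r) ⊃ so(r-1) ⊃ ⋯ ⊃ so(2)`, where
each restriction is decomposed into a multiplicity free direct sum of irreducible modules. -/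
inductive IsGTSystem (T : Fin m → Fin m → Module.End ℂ M) :
    ℕ → Submodule ℂ M → Set M → Prop
  | base (V : Submodule ℂ M) (E : Set M) (hV : IsSoIrreducible T 2 V)
      (v : M) (hv : v ∈ V) (hv0 : v ≠ 0) (hE : E = {v}) : IsGTSystem T 2 V E
  | step (r : ℕ) (hr : 2 ≤ r) (V : Submodule ℂ M) (E : Set M) (hV : IsSoIrreducible T (r + 1) V)
      (N : ℕ) (W : Fin N → Submodule ℂ M) (F : Fin N → Set M)
      (hW : ∀ a, IsGTSystem T r (W a) (F a))
      (hne : ∀ a b, a ≠ b → ¬ SoEquivalent T r (W a) (W b))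
      (hind : iSupIndep W) (hsum : ⨆ a, W a = V) (hE : E = ⋃ a, F a) :
      IsGTSystem T (r + 1) V E

/-- `B` restricts to an `so(m)`-invariant (Hermitian, positive definite) inner product on `V`.
Only the values of `B` on `V` matter. -/
structure IsInvariantInner (T : Fin m → Fin m → Module.End ℂ M) (V : Submodule ℂ M)
    (B : M →ₗ⋆[ℂ] M →ₗ[ℂ] ℂ) : Prop where
  conj_symm : ∀ u ∈ V, ∀ v ∈ V, B v u = (starRingEnd ℂ) (B u v)
  pos : ∀ u ∈ V, u ≠ 0 → 0 < (B u u).re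
  invariant : ∀ i j : Fin m, i < j → ∀ u ∈ V, ∀ v ∈ V, B (T i j u) v = -B u (T i j v)

/-- `E` is a Gelfand–Tsetlin basis of the irreducible `so(m)`-module `V`: a basis of `V`,
orthogonal for every invariant inner product, obtained from the chain
`so(m) ⊃ so(m-1) ⊃ ⋯ ⊃ so(2)`. -/
structure IsGTBasis (T : Fin m → Fin m → Module.End ℂ M) (V : Submodule ℂ M) (E : Set M) :
    Prop where
  system : IsGTSystem T m V E
  linearIndep : LinearIndepOn ℂ id E
  span_eq : Submodule.span ℂ E = V
  orthogonal : ∀ B : M →ₗ⋆[ℂ] M →ₗ[ℂ] ℂ, IsInvariantInner T V B →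
    ∀ u ∈ E, ∀ v ∈ E, u ≠ v → B u v = 0

end GT

/-! Clifford algebra valued polynomials and spherical monogenics.

`A` is the algebra of values and `e : Fin d → A` the vectors `e_1, …, e_d` used in dimension `d`.
-/

section Monogenic

variable {d : ℕ} {A : Type} [Ring A] [Algebra ℂ A]

/-- `A`-valued polynomials on `ℝᵈ`; `p ⊗ₜ a` is `x ↦ p(x) a`, and the product is pointwise. -/
abbrev VPoly (d : ℕ) (A : Type) [Ring A] [Algebra ℂ A] : Type :=
  MvPolynomial (Fin d) ℂ ⊗[ℂ] A

/-- The partial derivative `∂/∂x_i`. -/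
noncomputable def partialD (i : Fin d) : Module.End ℂ (VPoly d A) :=
  LinearMap.rTensor A ((MvPolynomial.pderiv i : Derivation ℂ (MvPolynomial (Fin d) ℂ)
    (MvPolynomial (Fin d) ℂ)) : MvPolynomial (Fin d) ℂ →ₗ[ℂ] MvPolynomial (Fin d) ℂ)

/-- Multiplication by the coordinate `x_i`. -/
noncomputable def mulX (i : Fin d) : Module.End ℂ (VPoly d A) :=
  LinearMap.mulLeft ℂ ((MvPolynomial.X i : MvPolynomial (Fin d) ℂ) ⊗ₜ[ℂ] (1 : A))

/-- Left multiplication of the values by `a`. -/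
noncomputable def mulVal (a : A) : Module.End ℂ (VPoly d A) :=
  LinearMap.mulLeft ℂ ((1 : MvPolynomial (Fin d) ℂ) ⊗ₜ[ℂ] a)

/-- The Dirac operator `∑ e_i ∂/∂x_i`. -/
noncomputable def dirac (e : Fin d → A) : Module.End ℂ (VPoly d A) :=
  ∑ i, mulVal (e i) ∘ₗ partialD i

/-- The derived `L`-action of `e_i e_j / 2`: `½ e_i e_j + x_j ∂/∂x_i - x_i ∂/∂x_j`. -/
noncomputable def soAction (e : Fin d → A) (i j : Fin d) : Module.End ℂ (VPoly d A) :=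
  (1 / 2 : ℂ) • mulVal (e i * e j) + mulX j ∘ₗ partialD i - mulX i ∘ₗ partialD j

/-- `S`-valued polynomials on `ℝᵈ`, homogeneous of degree `k`. -/
noncomputable def homPoly (d : ℕ) (S : Submodule ℂ A) (k : ℕ) : Submodule ℂ (VPoly d A) :=
  LinearMap.range
    (TensorProduct.map (MvPolynomial.homogeneousSubmodule (Fin d) ℂ k).subtype S.subtype)

/-- Spherical monogenics: `{P : P` is `S`-valued, `k`-homogeneous, `∂ P = 0}`. -/
noncomputable def monogenics (e : Fin d → A) (S : Submodule ℂ A) (k : ℕ) :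
    Submodule ℂ (VPoly d A) :=
  homPoly d S k ⊓ LinearMap.ker (dirac e)

/-- A polynomial in `(x_1, …, x_d)` regarded as a polynomial in `(x_1, …, x_{d+1})`. -/
noncomputable def extendVar : VPoly d A →ₗ[ℂ] VPoly (d + 1) A :=
  LinearMap.rTensor A (MvPolynomial.rename (Fin.castSucc : Fin d → Fin (d + 1)) :
    MvPolynomial (Fin d) ℂ →ₐ[ℂ] MvPolynomial (Fin (d + 1)) ℂ).toLinearMap

end Monogenic

/-! Gegenbauer polynomials and the polynomials `X^{(j)}` -/

/-- The coefficient of `(2z)^{j-2i}` in the Gegenbauer polynomial `C^ν_j`. -/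
noncomputable def gegenbauerCoeff (ν : ℂ) (j i : ℕ) : ℂ :=
  (-1) ^ i * (ascPochhammer ℂ (j - i)).eval ν / ((i.factorial : ℂ) * ((j - 2 * i).factorial : ℂ))

/-- The Gegenbauer polynomial `C^ν_j(z)`. -/
noncomputable def gegenbauer (ν : ℂ) (j : ℕ) (z : ℂ) : ℂ :=
  ∑ i ∈ Finset.range (j / 2 + 1), gegenbauerCoeff ν j i * (2 * z) ^ (j - 2 * i)

/-- `r² = x_1² + ⋯ + x_{d+1}²`. -/
noncomputable def rSq (d : ℕ) : MvPolynomial (Fin (d + 1)) ℂ := ∑ i, MvPolynomial.X i ^ 2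

/-- The polynomial `r^j C^ν_j(x_{d+1} / r)`. -/
noncomputable def gegenbauerHom (d : ℕ) (ν : ℂ) (j : ℕ) : MvPolynomial (Fin (d + 1)) ℂ :=
  ∑ i ∈ Finset.range (j / 2 + 1), MvPolynomial.C (gegenbauerCoeff ν j i) *
    (2 * MvPolynomial.X (Fin.last d)) ^ (j - 2 * i) * rSq d ^ i

theorem eval_gegenbauerHom (d : ℕ) (ν : ℂ) (j : ℕ) (x : Fin (d + 1) → ℝ) (r : ℝ) (hr : r ≠ 0)
    (hx : r ^ 2 = ∑ i, x i ^ 2) :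
    MvPolynomial.eval (fun i => (x i : ℂ)) (gegenbauerHom d ν j) =
      (r : ℂ) ^ j * gegenbauer ν j ((x (Fin.last d) : ℂ) / r) := by
  have hr' : (r : ℂ) ≠ 0 := by exact_mod_cast hr
  have hx' : ∑ i, (x i : ℂ) ^ 2 = (r : ℂ) ^ 2 := by exact_mod_cast hx.symm
  simp only [gegenbauerHom, gegenbauer, rSq, map_sum, map_mul, map_pow, MvPolynomial.eval_C,
    MvPolynomial.eval_X, hx', Finset.mul_sum, map_ofNat]
  refine Finset.sum_congr rfl fun i hi => ?_
  have h2 : 2 * i ≤ j := by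
    have := Finset.mem_range.mp hi
    omega
  obtain ⟨l, rfl⟩ := Nat.exists_eq_add_of_le h2
  rw [Nat.add_sub_cancel_left, ← mul_div_assoc, div_pow, pow_add, pow_mul]
  field_simp

/-- The normalising constant `μ^j_k` in dimension `m`. -/
noncomputable def muConst (m j k : ℕ) : ℂ :=
  if Even j then (-1) ^ (j / 2) * (gegenbauer ((m : ℂ) / 2 + k - 1) j 0)⁻¹
  else (-1) ^ (j / 2) * (((m : ℂ) + 2 * k + 2 * (j / 2 : ℕ) - 1) / ((m : ℂ) + 2 * k - 2)) *
    (gegenbauer ((m : ℂ) / 2 + k) (2 * (j / 2)) 0)⁻¹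

section XPoly

variable {d : ℕ} {A : Type} [Ring A] [Algebra ℂ A]

/-- `x̲ e_m = (x_1 e_1 + ⋯ + x_{m-1} e_{m-1}) e_m`, where `m = d + 1`. -/
noncomputable def xe (e : Fin (d + 1) → A) : VPoly (d + 1) A :=
  ∑ i : Fin d, (MvPolynomial.X i.castSucc : MvPolynomial (Fin (d + 1)) ℂ) ⊗ₜ[ℂ]
    (e i.castSucc * e (Fin.last d))

/-- The polynomial `X^{(j)} = X^{(j)}_k`, `m = d + 1`: `X^{(0)} = 1` and, for `j ≥ 1`,
`μ^j_k r^j (C_j^{m/2+k-1}(x_m/r) + (m+2k-2)/(m+2k+j-2) C_{j-1}^{m/2+k}(x_m/r) x̲ e_m / r)`. -/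
noncomputable def XPoly (e : Fin (d + 1) → A) : ℕ → ℕ → VPoly (d + 1) A
  | 0, _ => 1
  | j + 1, k =>
    muConst (d + 1) (j + 1) k •
      (gegenbauerHom d (((d + 1 : ℕ) : ℂ) / 2 + k - 1) (j + 1) ⊗ₜ[ℂ] (1 : A) +
        ((((d + 1 : ℕ) : ℂ) + 2 * k - 2) / (((d + 1 : ℕ) : ℂ) + 2 * k + (j + 1 : ℕ) - 2)) •
          (gegenbauerHom d (((d + 1 : ℕ) : ℂ) / 2 + k) j ⊗ₜ[ℂ] (1 : A) * xe e))

end XPoly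

/-! Put m = d + 1, so d ≥ 3, and 2ν = d + 2l - 1. Up to a nonzero constant X^{(j)}_l is the
homogenised multiplier C^ν_j + 2ν/(2ν+j) C^{ν+1}_{j-1} x̲ e_m (`gegenbauerX`). For p ∈ M_l(R^d) the
product X^{(j)}_l p is monogenic on R^m (`dirac_gegenbauerX`), the map p ↦ X^{(j)}_l p commutes with
so(d) (`soAction_gegenbauerX`), and for j ≥ 1 the derivative ∂_m X^{(j)}_l p is a nonzero multiple
of X^{(j-1)}_l p (`partialD_last_gegenbauerX`).

The last (Appell) property yields the branching law. If q ∈ M_k(R^m), then ∂_m q has degree k - 1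
and is, by induction, a sum of such products; integrating each of them leaves a remainder that does
not depend on x_m and so lies in M_k(R^d). Hence M_k(R^m) is the sum of the spaces X^{(j)}_{k-j}
M_{k-j}(R^d), 0 ≤ j ≤ k (`exists_gegenbauerX_decomposition`).

The so(d)-Casimir acts on the summands by distinct real scalars (`casimirSum_monogenics`,
`casimirScalar_injective`). Therefore the sum is direct, the summands are pairwise inequivalent and,
the Casimir being self-adjoint, they are orthogonal for every invariant inner product. Inside one
summand, everything is transported from M_{k-j}(R^d) along the injective intertwiner `XPolyMap`.

A GT system also requires M_k(R^m) to be irreducible, while the given bases supply irreducibility in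
dimension d only. Let U ≠ 0 be an invariant subspace. It contains q with ∂_m^k q ≠ 0
(`exists_partialD_last_pow_ne_zero`), so q has a nonzero component in the summand j = k, and the
Casimir isolates that component inside U (`exists_mem_branch_ne_zero`). To descend from j + 1 to j,
take f ∈ S annihilated by the null vector e_1 - i e_2 and z = x_1 - i x_2: the action of the
bivector (e_1 - i e_2) e_m sends X^{(j+1)}_l z^l f to a nonzero multiple of X^{(j)}_{l+1} z^{l+1} f
(`raising_gegenbauerX`). So U contains every summand. -/

/-! ### Coefficients and monomials of the Gegenbauer polynomials -/

/-- The coefficient of `w ^ a ρ ^ i` in the homogeneous Gegenbauer polynomial. -/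
noncomputable def gegenbauerMonoCoeff (ν : ℂ) (a i : ℕ) : ℂ :=
  (-1) ^ i * (ascPochhammer ℂ (a + i)).eval ν / ((i.factorial : ℂ) * (a.factorial : ℂ))

theorem ascPochhammer_eval_succ_left (ν : ℂ) (N : ℕ) :
    (ascPochhammer ℂ (N + 1)).eval ν = ν * (ascPochhammer ℂ N).eval (ν + 1) := by
  rw [ascPochhammer_succ_left]
  simp

/-- All shift relations rest on (ν)_{N+1} = ν (ν+1)_N. They are the coefficient form of calculus
with the generating function Σ r^n C^ν_n t^n = (1 - w t + ρ t²)^{-ν}, where w = 2 x_m and ρ = r².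
Indexing by the exponents (a, i) avoids the truncated difference n - 2i. -/
theorem gegenbauerMonoCoeff_succ_left (ν : ℂ) (a i : ℕ) :
    gegenbauerMonoCoeff ν (a + 1) i * ((a : ℂ) + 1) = ν * gegenbauerMonoCoeff (ν + 1) a i := by
  have h1 : (a.factorial : ℂ) ≠ 0 := by exact_mod_cast a.factorial_ne_zero
  have h2 : ((a : ℂ) + 1) ≠ 0 := by exact_mod_cast a.succ_ne_zero
  have h3 : (i.factorial : ℂ) ≠ 0 := by exact_mod_cast i.factorial_ne_zero
  rw [gegenbauerMonoCoeff, gegenbauerMonoCoeff, Nat.factorial_succ,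
    show a + 1 + i = (a + i) + 1 by omega, ascPochhammer_eval_succ_left]
  push_cast
  field_simp

theorem gegenbauerMonoCoeff_succ_right (ν : ℂ) (a i : ℕ) :
    gegenbauerMonoCoeff ν a (i + 1) * ((i : ℂ) + 1) = -ν * gegenbauerMonoCoeff (ν + 1) a i := by
  have h1 : (a.factorial : ℂ) ≠ 0 := by exact_mod_cast a.factorial_ne_zero
  have h2 : ((i : ℂ) + 1) ≠ 0 := by exact_mod_cast i.succ_ne_zero
  have h3 : (i.factorial : ℂ) ≠ 0 := by exact_mod_cast i.factorial_ne_zero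
  rw [gegenbauerMonoCoeff, gegenbauerMonoCoeff, Nat.factorial_succ,
    ← add_assoc, ascPochhammer_eval_succ_left]
  push_cast
  field_simp
  ring

theorem gegenbauerMonoCoeff_mul_add (ν : ℂ) (a i : ℕ) :
    gegenbauerMonoCoeff ν a i * (ν + a + i) = ν * gegenbauerMonoCoeff (ν + 1) a i := by
  have := ascPochhammer_eval_succ_left ν (a + i)
  rw [ascPochhammer_succ_right, Polynomial.eval_mul] at this
  simp only [Polynomial.eval_add, Polynomial.eval_X, Polynomial.eval_natCast] at this
  rw [gegenbauerMonoCoeff, gegenbauerMonoCoeff]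
  push_cast at this
  linear_combination (-1) ^ i / ((i.factorial : ℂ) * (a.factorial : ℂ)) * this

section Abstract

variable {P : Type*} [CommRing P] [Algebra ℂ P]

/-- The monomial `w ^ a ρ ^ i` of the homogeneous Gegenbauer polynomial, zero for `a < 0`. -/
noncomputable def gegenbauerTerm (w ρ : P) (ν : ℂ) (i : ℕ) : ℤ → P
  | .ofNat a => gegenbauerMonoCoeff ν a i • (w ^ a * ρ ^ i)
  | .negSucc _ => 0

theorem gegenbauerTerm_natCast (w ρ : P) (ν : ℂ) (i a : ℕ) :
    gegenbauerTerm w ρ ν i a = gegenbauerMonoCoeff ν a i • (w ^ a * ρ ^ i) := rfl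

theorem gegenbauerTerm_zero (w ρ : P) (ν : ℂ) (i : ℕ) :
    gegenbauerTerm w ρ ν i 0 = gegenbauerMonoCoeff ν 0 i • ρ ^ i := by
  rw [← Int.natCast_zero, gegenbauerTerm_natCast, pow_zero, one_mul]

theorem gegenbauerTerm_of_neg (w ρ : P) (ν : ℂ) (i : ℕ) {n : ℤ} (hn : n < 0) :
    gegenbauerTerm w ρ ν i n = 0 := by
  cases n with
  | ofNat n => exact absurd hn (by simp)
  | negSucc n => rfl

/-- The term i = 0 stands apart because it has no ρ to differentiate. The integer index makes the
lowered exponent a - 1 harmless at a = 0. -/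
theorem derivation_gegenbauerTerm_zero (w ρ : P) (ν : ℂ) (δ : Derivation ℂ P P) (a : ℤ) :
    δ (gegenbauerTerm w ρ ν 0 a) = ν • (gegenbauerTerm w ρ (ν + 1) 0 (a - 1) * δ w) := by
  rcases lt_trichotomy a 0 with h | rfl | h
  · simp [gegenbauerTerm_of_neg _ _ _ _ h, gegenbauerTerm_of_neg _ _ _ _ (show a - 1 < 0 by omega)]
  · rw [gegenbauerTerm_of_neg _ _ (ν + 1) _ (by omega), gegenbauerTerm_zero]
    simp
  · obtain ⟨a, rfl⟩ : ∃ b : ℕ, a = (b : ℤ) + 1 := ⟨(a - 1).toNat, by omega⟩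
    rw [add_sub_cancel_right, ← Nat.cast_succ, gegenbauerTerm_natCast, gegenbauerTerm_natCast]
    have hc := congrArg (algebraMap ℂ P) (gegenbauerMonoCoeff_succ_left ν a 0)
    simp only [map_mul, map_add, map_natCast, map_one] at hc
    rw [Derivation.map_smul]
    simp only [Derivation.leibniz_pow, pow_zero, mul_one, Nat.succ_eq_add_one,
      Nat.add_sub_cancel, Algebra.smul_def]
    push_cast
    linear_combination w ^ a * δ w * hc

theorem derivation_gegenbauerTerm_succ (w ρ : P) (ν : ℂ) (δ : Derivation ℂ P P) (i : ℕ) (a : ℤ) :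
    δ (gegenbauerTerm w ρ ν (i + 1) a) =
      ν • (gegenbauerTerm w ρ (ν + 1) (i + 1) (a - 1) * δ w -
        gegenbauerTerm w ρ (ν + 1) i a * δ ρ) := by
  rcases lt_trichotomy a 0 with h | rfl | h
  · simp [gegenbauerTerm_of_neg _ _ _ _ h, gegenbauerTerm_of_neg _ _ _ _ (show a - 1 < 0 by omega)]
  · rw [gegenbauerTerm_of_neg _ _ (ν + 1) _ (by omega), gegenbauerTerm_zero, gegenbauerTerm_zero]
    have hc := congrArg (algebraMap ℂ P) (gegenbauerMonoCoeff_succ_right ν 0 i)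
    simp only [map_mul, map_add, map_natCast, map_one, map_neg] at hc
    rw [Derivation.map_smul]
    simp only [Derivation.leibniz_pow,
      Nat.add_sub_cancel, Algebra.smul_def]
    push_cast
    linear_combination ρ ^ i * δ ρ * hc
  · obtain ⟨a, rfl⟩ : ∃ b : ℕ, a = (b : ℤ) + 1 := ⟨(a - 1).toNat, by omega⟩
    rw [add_sub_cancel_right, ← Nat.cast_succ, gegenbauerTerm_natCast, gegenbauerTerm_natCast,
      gegenbauerTerm_natCast]
    have hc := congrArg (algebraMap ℂ P) (gegenbauerMonoCoeff_succ_left ν a (i + 1))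
    have hc' := congrArg (algebraMap ℂ P) (gegenbauerMonoCoeff_succ_right ν (a + 1) i)
    simp only [map_mul, map_add, map_natCast, map_one, map_neg] at hc hc'
    rw [Derivation.map_smul]
    simp only [Derivation.leibniz, Derivation.leibniz_pow, Nat.succ_eq_add_one,
      Nat.add_sub_cancel, Algebra.smul_def]
    push_cast
    linear_combination w ^ a * ρ ^ (i + 1) * δ w * hc + w ^ (a + 1) * ρ ^ i * δ ρ * hc'

theorem cast_mul_gegenbauerTerm (w ρ : P) (ν : ℂ) (i : ℕ) (a : ℤ) :
    (a : P) * gegenbauerTerm w ρ ν i a = ν • (gegenbauerTerm w ρ (ν + 1) i (a - 1) * w) := by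
  rcases lt_trichotomy a 0 with h | rfl | h
  · simp [gegenbauerTerm_of_neg _ _ _ _ h, gegenbauerTerm_of_neg _ _ _ _ (show a - 1 < 0 by omega)]
  · rw [gegenbauerTerm_of_neg _ _ (ν + 1) _ (by omega)]
    simp
  · obtain ⟨a, rfl⟩ : ∃ b : ℕ, a = (b : ℤ) + 1 := ⟨(a - 1).toNat, by omega⟩
    rw [add_sub_cancel_right, ← Nat.cast_succ, gegenbauerTerm_natCast, gegenbauerTerm_natCast]
    have hc := congrArg (algebraMap ℂ P) (gegenbauerMonoCoeff_succ_left ν a i)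
    simp only [map_mul, map_add, map_natCast, map_one] at hc
    simp only [Nat.succ_eq_add_one, Algebra.smul_def]
    push_cast
    linear_combination w ^ (a + 1) * ρ ^ i * hc

theorem succ_mul_gegenbauerTerm (w ρ : P) (ν : ℂ) (i : ℕ) (a : ℤ) :
    ((i : P) + 1) * gegenbauerTerm w ρ ν (i + 1) a =
      -ν • (gegenbauerTerm w ρ (ν + 1) i a * ρ) := by
  rcases lt_or_ge a 0 with h | h
  · simp [gegenbauerTerm_of_neg _ _ _ _ h]
  · obtain ⟨a, rfl⟩ := Int.eq_ofNat_of_zero_le h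
    rw [gegenbauerTerm_natCast, gegenbauerTerm_natCast]
    have hc := congrArg (algebraMap ℂ P) (gegenbauerMonoCoeff_succ_right ν a i)
    simp only [map_mul, map_add, map_natCast, map_one, map_neg] at hc
    simp only [Algebra.smul_def, map_neg]
    linear_combination w ^ a * ρ ^ (i + 1) * hc

/-- Both sides of `(a + i + ν) b_{a,i}(ν) = ν b_{a,i}(ν + 1)` as monomials. -/
theorem mul_add_gegenbauerTerm (w ρ : P) (ν : ℂ) (i : ℕ) (a : ℤ) :
    (algebraMap ℂ P ν + a + i) * gegenbauerTerm w ρ ν i a = ν • gegenbauerTerm w ρ (ν + 1) i a := by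
  rcases lt_or_ge a 0 with h | h
  · simp [gegenbauerTerm_of_neg _ _ _ _ h]
  · obtain ⟨a, rfl⟩ := Int.eq_ofNat_of_zero_le h
    rw [gegenbauerTerm_natCast, gegenbauerTerm_natCast]
    have hc := congrArg (algebraMap ℂ P) (gegenbauerMonoCoeff_mul_add ν a i)
    simp only [map_mul, map_add, map_natCast] at hc
    simp only [Algebra.smul_def]
    push_cast
    linear_combination w ^ a * ρ ^ i * hc

end Abstract

/-! ### Differential and recurrence identities for homogeneous Gegenbauer polynomials -/

section Identities

variable (d : ℕ) (ν : ℂ)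

local notation "w" => (2 * MvPolynomial.X (Fin.last d) : MvPolynomial (Fin (d + 1)) ℂ)

/-- `r^n C^ν_n(x_{d+1} / r)`, extended by zero to negative `n`. -/
noncomputable def gegenbauerInt (d : ℕ) (ν : ℂ) : ℤ → MvPolynomial (Fin (d + 1)) ℂ
  | .ofNat n => gegenbauerHom d ν n
  | .negSucc _ => 0

theorem gegenbauerInt_natCast (n : ℕ) : gegenbauerInt d ν n = gegenbauerHom d ν n := rfl

theorem gegenbauerInt_of_neg {n : ℤ} (hn : n < 0) : gegenbauerInt d ν n = 0 := by
  cases n with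
  | ofNat n => exact absurd hn (by simp)
  | negSucc n => rfl

theorem gegenbauerInt_zero : gegenbauerInt d ν 0 = 1 := by
  rw [← Int.natCast_zero, gegenbauerInt_natCast]
  simp [gegenbauerHom, gegenbauerCoeff]

/-- Terms of negative exponent vanish, so any large K will do; the degrees n, n - 1 and n - 2 can
thus share one summation range. -/
theorem gegenbauerInt_eq_sum (n : ℤ) (K : ℕ) (hK : n < 2 * K) :
    gegenbauerInt d ν n = ∑ i ∈ Finset.range K, gegenbauerTerm w (rSq d) ν i (n - 2 * i) := by
  rcases lt_or_ge n 0 with hn | hn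
  · rw [gegenbauerInt_of_neg d ν hn, Finset.sum_eq_zero]
    intro i _
    exact gegenbauerTerm_of_neg _ _ ν i (by omega)
  · obtain ⟨n, rfl⟩ := Int.eq_ofNat_of_zero_le hn
    rw [gegenbauerInt_natCast, gegenbauerHom]
    have hsub : Finset.range (n / 2 + 1) ⊆ Finset.range K := by
      intro i hi
      simp only [Finset.mem_range] at hi ⊢
      omega
    rw [← Finset.sum_subset hsub]
    · refine Finset.sum_congr rfl fun i hi => ?_
      have h2 : 2 * i ≤ n := by
        have := Finset.mem_range.mp hi
        omega
      obtain ⟨l, rfl⟩ := Nat.exists_eq_add_of_le h2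
      have e1 : ((2 * i + l : ℕ) : ℤ) - 2 * i = (l : ℕ) := by push_cast; ring
      rw [e1, gegenbauerTerm_natCast, gegenbauerCoeff, Nat.add_sub_cancel_left,
        show 2 * i + l - i = l + i by omega, gegenbauerMonoCoeff, MvPolynomial.smul_eq_C_mul,
        mul_assoc]
    · intro i _ hi
      refine gegenbauerTerm_of_neg _ _ ν i ?_
      simp only [Finset.mem_range] at hi
      omega

theorem gegenbauerInt_eq_add_sum (n : ℤ) (K : ℕ) (hK : n < 2 * (K + 1)) :
    gegenbauerInt d ν n = ∑ i ∈ Finset.range K,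
      gegenbauerTerm w (rSq d) ν (i + 1) (n - 2 * i - 2) + gegenbauerTerm w (rSq d) ν 0 n := by
  rw [gegenbauerInt_eq_sum d ν n (K + 1) (by exact_mod_cast hK), Finset.sum_range_succ']
  congr 1
  · refine Finset.sum_congr rfl fun i _ => ?_
    congr 1
    push_cast
    ring
  · simp

/-- The chain rule for the generating function: δ(1 - w t + ρ t²)^{-ν} = ν (1 - w t + ρ t²)^{-ν-1}
(t δw - t² δρ). For an arbitrary derivation δ, it covers all the partial derivatives at once. -/
theorem derivation_gegenbauerInt
    (δ : Derivation ℂ (MvPolynomial (Fin (d + 1)) ℂ) (MvPolynomial (Fin (d + 1)) ℂ)) (n : ℤ) :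
    δ (gegenbauerInt d ν n) = ν • (gegenbauerInt d (ν + 1) (n - 1) * δ w -
      gegenbauerInt d (ν + 1) (n - 2) * δ (rSq d)) := by
  obtain ⟨K, hK⟩ : ∃ K : ℕ, n < 2 * K := ⟨n.toNat + 1, by omega⟩
  rw [gegenbauerInt_eq_add_sum d ν n K (by omega),
    gegenbauerInt_eq_add_sum d (ν + 1) (n - 1) K (by omega),
    gegenbauerInt_eq_sum d (ν + 1) (n - 2) K (by omega), map_add, map_sum,
    derivation_gegenbauerTerm_zero]
  simp only [derivation_gegenbauerTerm_succ, ← Finset.smul_sum, Finset.sum_sub_distrib,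
    ← Finset.sum_mul, ← smul_add]
  congr 1
  have h1 : ∀ x : ℕ, n - 2 * x - 2 - 1 = n - 1 - 2 * x - 2 := fun x => by ring
  have h2 : ∀ x : ℕ, n - 2 * x - 2 = n - 2 - 2 * x := fun x => by ring
  simp only [h1]
  simp only [h2]
  ring

/-- The operator t d/dt applied to the generating function. -/
theorem euler_gegenbauerInt (n : ℤ) :
    (n : MvPolynomial (Fin (d + 1)) ℂ) * gegenbauerInt d ν n =
      (2 * MvPolynomial.C ν) * (gegenbauerInt d (ν + 1) (n - 1) * MvPolynomial.X (Fin.last d) -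
      gegenbauerInt d (ν + 1) (n - 2) * rSq d) := by
  obtain ⟨K, hK⟩ : ∃ K : ℕ, n < 2 * K := ⟨n.toNat + 1, by omega⟩
  rw [gegenbauerInt_eq_add_sum d ν n K (by omega),
    gegenbauerInt_eq_add_sum d (ν + 1) (n - 1) K (by omega),
    gegenbauerInt_eq_sum d (ν + 1) (n - 2) K (by omega), mul_add, Finset.mul_sum,
    cast_mul_gegenbauerTerm]
  have h0 : ∀ i ∈ Finset.range K, (n : MvPolynomial (Fin (d + 1)) ℂ) *
      gegenbauerTerm w (rSq d) ν (i + 1) (n - 2 * i - 2) =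
      ν • (gegenbauerTerm w (rSq d) (ν + 1) (i + 1) (n - 1 - 2 * i - 2) * w -
        2 * (gegenbauerTerm w (rSq d) (ν + 1) i (n - 2 - 2 * i) * rSq d)) := by
    intro i _
    have h1 := cast_mul_gegenbauerTerm w (rSq d) ν (i + 1) (n - 2 * i - 2)
    have h2 := succ_mul_gegenbauerTerm w (rSq d) ν i (n - 2 * i - 2)
    rw [show n - 2 * i - 2 - 1 = n - 1 - 2 * i - 2 by ring] at h1
    rw [show n - 2 - 2 * (i : ℤ) = n - 2 * i - 2 by ring]
    simp only [MvPolynomial.smul_eq_C_mul, map_neg] at h1 h2 ⊢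
    push_cast at h1 h2
    -- The weight n is split as (n - 2i - 2) + 2(i + 1): the degree in w plus twice the degree in ρ.
    linear_combination h1 + 2 * h2
  rw [Finset.sum_congr rfl h0]
  simp only [Finset.sum_sub_distrib, ← Finset.mul_sum,
    ← Finset.sum_mul, MvPolynomial.smul_eq_C_mul]
  ring

/-- `(n + 2ν) C^ν_n = 2ν (C^{ν+1}_n - z C^{ν+1}_{n-1})`. -/
theorem two_mul_add_gegenbauerInt (n : ℤ) :
    MvPolynomial.C (2 * ν + n) * gegenbauerInt d ν n =
      MvPolynomial.C (2 * ν) * (gegenbauerInt d (ν + 1) n -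
        MvPolynomial.X (Fin.last d) * gegenbauerInt d (ν + 1) (n - 1)) := by
  obtain ⟨K, hK⟩ : ∃ K : ℕ, n < 2 * K := ⟨n.toNat + 1, by omega⟩
  rw [gegenbauerInt_eq_sum d ν n K hK, gegenbauerInt_eq_sum d (ν + 1) n K hK,
    gegenbauerInt_eq_sum d (ν + 1) (n - 1) K (by omega), Finset.mul_sum, Finset.mul_sum,
    ← Finset.sum_sub_distrib, Finset.mul_sum]
  refine Finset.sum_congr rfl fun i _ => ?_
  have h1 := mul_add_gegenbauerTerm w (rSq d) ν i (n - 2 * i)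
  have h2 := cast_mul_gegenbauerTerm w (rSq d) ν i (n - 2 * i)
  rw [show n - 2 * i - 1 = n - 1 - 2 * i by ring] at h2
  have hn : (MvPolynomial.C (2 * ν + n) : MvPolynomial (Fin (d + 1)) ℂ) =
      2 * MvPolynomial.C ν + (n : MvPolynomial (Fin (d + 1)) ℂ) := by
    rw [map_add, map_mul, map_ofNat, map_intCast]
  rw [hn]
  simp only [MvPolynomial.algebraMap_eq, MvPolynomial.smul_eq_C_mul] at h1 h2
  push_cast at h1 h2
  simp only [map_mul, map_ofNat]
  -- With a = n - 2i one has 2ν + n = 2(ν + a + i) - a.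
  linear_combination 2 * h1 - h2

theorem pderiv_castSucc_rSq (i : Fin d) :
    MvPolynomial.pderiv i.castSucc (rSq d) = 2 * MvPolynomial.X i.castSucc := by
  rw [rSq, map_sum, Finset.sum_eq_single i.castSucc]
  · simp [Derivation.leibniz_pow]
  · intro b _ hb
    simp [Derivation.leibniz_pow, MvPolynomial.pderiv_X_of_ne hb]
  · simp

theorem pderiv_last_rSq :
    MvPolynomial.pderiv (Fin.last d) (rSq d) = 2 * MvPolynomial.X (Fin.last d) := by
  rw [rSq, map_sum, Finset.sum_eq_single (Fin.last d)]
  · simp [Derivation.leibniz_pow]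
  · intro b _ hb
    simp [Derivation.leibniz_pow, MvPolynomial.pderiv_X_of_ne hb]
  · simp

theorem pderiv_castSucc_gegenbauerInt (i : Fin d) (n : ℤ) :
    MvPolynomial.pderiv i.castSucc (gegenbauerInt d ν n) =
      -(MvPolynomial.C (2 * ν) * (MvPolynomial.X i.castSucc * gegenbauerInt d (ν + 1) (n - 2))) := by
  have h2 : MvPolynomial.pderiv i.castSucc w = 0 := by
    have h : (MvPolynomial.pderiv i.castSucc) (2 : MvPolynomial (Fin (d + 1)) ℂ) = 0 := by
      exact_mod_cast Derivation.map_natCast (MvPolynomial.pderiv i.castSucc) 2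
    rw [MvPolynomial.pderiv_mul, h, MvPolynomial.pderiv_X_of_ne (Fin.castSucc_lt_last i).ne']
    simp
  rw [derivation_gegenbauerInt, pderiv_castSucc_rSq, h2, MvPolynomial.smul_eq_C_mul, map_mul,
    map_ofNat]
  ring

/-- The chain rule gives 2ν (C^{ν+1}_{n-1} - x_m C^{ν+1}_{n-2}), which the recurrence in degree n -
1 contracts to a multiple of C^ν_{n-1}. The Appell property of X^{(n)} comes from here. -/
theorem pderiv_last_gegenbauerInt (n : ℤ) :
    MvPolynomial.pderiv (Fin.last d) (gegenbauerInt d ν n) =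
      MvPolynomial.C (2 * ν + n - 1) * gegenbauerInt d ν (n - 1) := by
  have h2 : MvPolynomial.pderiv (Fin.last d) w = 2 := by
    have h : (MvPolynomial.pderiv (Fin.last d)) (2 : MvPolynomial (Fin (d + 1)) ℂ) = 0 := by
      exact_mod_cast Derivation.map_natCast (MvPolynomial.pderiv (Fin.last d)) 2
    rw [MvPolynomial.pderiv_mul, h, MvPolynomial.pderiv_X_self]
    simp
  have h := two_mul_add_gegenbauerInt d ν (n - 1)
  rw [show n - 1 - 1 = n - 2 by ring, map_mul, map_ofNat] at h
  rw [derivation_gegenbauerInt, pderiv_last_rSq, h2, MvPolynomial.smul_eq_C_mul, add_sub_assoc,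
    show (n : ℂ) - 1 = ((n - 1 : ℤ) : ℂ) by push_cast; rfl, h]
  ring

/-- The identity behind the monogenicity of the polynomials `X^{(j)}`. -/
theorem gegenbauerInt_dirac_identity (n : ℤ) :
    MvPolynomial.C (2 * ν + 1) * gegenbauerInt d (ν + 1) n -
      MvPolynomial.C (2 * (ν + 1)) * ((rSq d - MvPolynomial.X (Fin.last d) ^ 2) *
        gegenbauerInt d (ν + 2) (n - 2)) =
    MvPolynomial.C (2 * ν + n + 1) * (gegenbauerInt d (ν + 1) n -
      MvPolynomial.X (Fin.last d) * gegenbauerInt d (ν + 1) (n - 1)) := by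
  have h1 := euler_gegenbauerInt d (ν + 1) n
  have h2 := two_mul_add_gegenbauerInt d (ν + 1) (n - 1)
  rw [show n - 1 - 1 = n - 2 by ring] at h2
  rw [show ν + 1 + 1 = ν + 2 by ring] at h1 h2
  simp only [map_add, map_mul, map_ofNat, map_one, map_intCast] at h1 h2 ⊢
  push_cast at h1 h2 ⊢
  -- Euler's identity trades the r² term for one in C^{ν+2}_{n-1}, and the recurrence in degree n -
  -- 1 absorbs the latter together with the x_m² term.
  linear_combination -h1 + MvPolynomial.X (Fin.last d) * h2

theorem gegenbauerHom_isHomogeneous (n : ℕ) : (gegenbauerHom d ν n).IsHomogeneous n := by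
  refine MvPolynomial.IsHomogeneous.sum _ _ _ fun i hi => ?_
  have h2 : 2 * i ≤ n := by
    have := Finset.mem_range.mp hi
    omega
  have hw : (w).IsHomogeneous 1 := by
    have h := (MvPolynomial.isHomogeneous_C (Fin (d + 1)) (2 : ℂ)).mul
      (MvPolynomial.isHomogeneous_X ℂ (Fin.last d))
    rwa [map_ofNat, zero_add] at h
  have hr : (rSq d).IsHomogeneous 2 := by
    refine MvPolynomial.IsHomogeneous.sum _ _ _ fun i _ => ?_
    simpa using (MvPolynomial.isHomogeneous_X ℂ i).pow 2
  have h := ((MvPolynomial.isHomogeneous_C (Fin (d + 1)) (gegenbauerCoeff ν n i)).mul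
    (hw.pow (n - 2 * i))).mul (hr.pow i)
  rwa [show 0 + 1 * (n - 2 * i) + 2 * i = n by omega] at h

end Identities

/-! ### Calculus of algebra-valued polynomials -/

section Calculus

variable {d : ℕ} {A : Type} [Ring A] [Algebra ℂ A]

theorem poly_smul_eq_mul (f : MvPolynomial (Fin d) ℂ) (q : VPoly d A) :
    f • q = (f ⊗ₜ[ℂ] (1 : A)) * q := by
  induction q using TensorProduct.induction_on with
  | zero => simp
  | tmul g a =>
    rw [TensorProduct.smul_tmul', smul_eq_mul, Algebra.TensorProduct.tmul_mul_tmul, one_mul]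
  | add x y hx hy => rw [smul_add, hx, hy, mul_add]

theorem poly_smul_tmul (f g : MvPolynomial (Fin d) ℂ) (a : A) :
    f • (g ⊗ₜ[ℂ] a) = (f * g) ⊗ₜ[ℂ] a := by
  rw [TensorProduct.smul_tmul', smul_eq_mul]

/-- Turns complex scalars into polynomial ones, so that `module` can work over the single ring of
polynomials. -/
theorem C_smul_vpoly (c : ℂ) (q : VPoly d A) :
    (MvPolynomial.C c : MvPolynomial (Fin d) ℂ) • q = c • q := by
  rw [← MvPolynomial.algebraMap_eq, algebraMap_smul]

theorem mulX_apply (i : Fin d) (q : VPoly d A) :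
    mulX i q = (MvPolynomial.X i : MvPolynomial (Fin d) ℂ) • q := by
  rw [poly_smul_eq_mul]
  rfl

theorem mulVal_apply (a : A) (q : VPoly d A) :
    mulVal a q = ((1 : MvPolynomial (Fin d) ℂ) ⊗ₜ[ℂ] a) * q := rfl

theorem mulVal_tmul (a b : A) (f : MvPolynomial (Fin d) ℂ) :
    mulVal a (f ⊗ₜ[ℂ] b) = f ⊗ₜ[ℂ] (a * b) := by
  rw [mulVal_apply, Algebra.TensorProduct.tmul_mul_tmul, one_mul]

theorem mulVal_mulVal (a b : A) (q : VPoly d A) :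
    mulVal a (mulVal b q) = mulVal (a * b) q := by
  rw [mulVal_apply, mulVal_apply, mulVal_apply, ← mul_assoc,
    Algebra.TensorProduct.tmul_mul_tmul, one_mul]

theorem mulVal_smul (a : A) (f : MvPolynomial (Fin d) ℂ) (q : VPoly d A) :
    mulVal a (f • q) = f • mulVal a q := by
  simp only [mulVal_apply, mul_smul_comm]

theorem mulVal_add_left (a b : A) (q : VPoly d A) :
    mulVal (a + b) q = mulVal a q + mulVal b q := by
  simp only [mulVal_apply, TensorProduct.tmul_add, add_mul]

theorem mulVal_smul_left (c : ℂ) (a : A) (q : VPoly d A) :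
    mulVal (c • a) q = c • mulVal a q := by
  simp only [mulVal_apply, TensorProduct.tmul_smul, smul_mul_assoc]

theorem mulVal_neg_left (a : A) (q : VPoly d A) :
    mulVal (-a) q = -mulVal a q := by
  have h := mulVal_smul_left (-1) a q
  rw [neg_one_smul] at h
  exact h.trans (by module)

theorem mulVal_one (q : VPoly d A) : mulVal 1 q = q := by
  rw [mulVal_apply, ← Algebra.TensorProduct.one_def, one_mul]

theorem mulVal_zero_left (q : VPoly d A) : mulVal 0 q = 0 := by
  rw [mulVal_apply, TensorProduct.tmul_zero, zero_mul]

theorem partialD_tmul (i : Fin d) (f : MvPolynomial (Fin d) ℂ) (a : A) :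
    partialD i (f ⊗ₜ[ℂ] a) = (MvPolynomial.pderiv i f) ⊗ₜ[ℂ] a := rfl

theorem partialD_smul (i : Fin d) (f : MvPolynomial (Fin d) ℂ) (q : VPoly d A) :
    partialD i (f • q) = (MvPolynomial.pderiv i f) • q + f • partialD i q := by
  induction q using TensorProduct.induction_on with
  | zero => simp
  | tmul g a =>
    rw [poly_smul_tmul, partialD_tmul, partialD_tmul, poly_smul_tmul, poly_smul_tmul,
      ← TensorProduct.add_tmul, MvPolynomial.pderiv_mul]
  | add x y hx hy =>
    rw [smul_add, map_add, hx, hy, map_add]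
    module

theorem partialD_mulVal (i : Fin d) (a : A) (q : VPoly d A) :
    partialD i (mulVal a q) = mulVal a (partialD i q) := by
  induction q using TensorProduct.induction_on with
  | zero => simp
  | tmul g b => rw [mulVal_tmul, partialD_tmul, partialD_tmul, mulVal_tmul]
  | add x y hx hy => simp only [map_add, hx, hy]

theorem pderiv_comm {σ : Type*} (i j : σ) (f : MvPolynomial σ ℂ) :
    MvPolynomial.pderiv i (MvPolynomial.pderiv j f) =
      MvPolynomial.pderiv j (MvPolynomial.pderiv i f) := by
  classical
  have h : ⁅(MvPolynomial.pderiv i : Derivation ℂ (MvPolynomial σ ℂ) (MvPolynomial σ ℂ)),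
      (MvPolynomial.pderiv j : Derivation ℂ (MvPolynomial σ ℂ) (MvPolynomial σ ℂ))⁆ = 0 := by
    refine MvPolynomial.derivation_ext fun l => ?_
    rw [Derivation.commutator_apply]
    simp [MvPolynomial.pderiv_X, Pi.single_apply, apply_ite]
  rw [← sub_eq_zero, ← Derivation.commutator_apply, h, Derivation.zero_apply]

theorem partialD_comm (i j : Fin d) (q : VPoly d A) :
    partialD i (partialD j q) = partialD j (partialD i q) := by
  induction q using TensorProduct.induction_on with
  | zero => simp
  | tmul g b =>
    simp only [partialD_tmul]
    rw [pderiv_comm]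
  | add x y hx hy => simp only [map_add, hx, hy]

theorem soAction_apply (e : Fin d → A) (i j : Fin d) (q : VPoly d A) :
    soAction e i j q = (1 / 2 : ℂ) • mulVal (e i * e j) q +
      (MvPolynomial.X j : MvPolynomial (Fin d) ℂ) • partialD i q -
      (MvPolynomial.X i : MvPolynomial (Fin d) ℂ) • partialD j q := by
  simp only [soAction, LinearMap.sub_apply, LinearMap.add_apply, LinearMap.smul_apply,
    LinearMap.comp_apply, mulX_apply]

theorem dirac_apply (e : Fin d → A) (q : VPoly d A) :
    dirac e q = ∑ i, mulVal (e i) (partialD i q) := by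
  simp only [dirac, LinearMap.sum_apply, LinearMap.comp_apply]

/-- The Euler operator. -/
noncomputable def eulerD (q : VPoly d A) : VPoly d A :=
  ∑ i, (MvPolynomial.X i : MvPolynomial (Fin d) ℂ) • partialD i q

/-! Homogeneous `S`-valued polynomials -/

theorem homPoly_eq_span (S : Submodule ℂ A) (k : ℕ) :
    homPoly d S k = Submodule.span ℂ {q | ∃ f : MvPolynomial (Fin d) ℂ, f.IsHomogeneous k ∧
      ∃ s ∈ S, q = f ⊗ₜ[ℂ] s} := by
  rw [homPoly, TensorProduct.range_map_eq_span_tmul]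
  congr 1
  ext q
  constructor
  · rintro ⟨f, s, rfl⟩
    exact ⟨f, (MvPolynomial.mem_homogeneousSubmodule k _).1 f.2, s, s.2, rfl⟩
  · rintro ⟨f, hf, s, hs, rfl⟩
    exact ⟨⟨f, (MvPolynomial.mem_homogeneousSubmodule k _).2 hf⟩, ⟨s, hs⟩, rfl⟩

theorem tmul_mem_homPoly {S : Submodule ℂ A} {k : ℕ} {f : MvPolynomial (Fin d) ℂ}
    (hf : f.IsHomogeneous k) {s : A} (hs : s ∈ S) : f ⊗ₜ[ℂ] s ∈ homPoly d S k := by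
  rw [homPoly_eq_span]
  exact Submodule.subset_span ⟨f, hf, s, hs, rfl⟩

/-- Reduces claims about homogeneous S-valued polynomials to pure tensors; with N = ⊥ it proves
identities. -/
theorem map_mem_of_homPoly {M : Type*} [AddCommGroup M] [Module ℂ M] {S : Submodule ℂ A} {k : ℕ}
    (φ : VPoly d A →ₗ[ℂ] M) (N : Submodule ℂ M)
    (h : ∀ f : MvPolynomial (Fin d) ℂ, f.IsHomogeneous k → ∀ s ∈ S, φ (f ⊗ₜ[ℂ] s) ∈ N)
    {q : VPoly d A} (hq : q ∈ homPoly d S k) : φ q ∈ N := by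
  have : homPoly d S k ≤ N.comap φ := by
    rw [homPoly_eq_span, Submodule.span_le]
    rintro _ ⟨f, hf, s, hs, rfl⟩
    exact h f hf s hs
  exact this hq

theorem smul_mem_homPoly {S : Submodule ℂ A} {k l : ℕ} {g : MvPolynomial (Fin d) ℂ}
    (hg : g.IsHomogeneous l) {q : VPoly d A} (hq : q ∈ homPoly d S k) :
    g • q ∈ homPoly d S (l + k) :=
  map_mem_of_homPoly (Module.toModuleEnd ℂ (S := MvPolynomial (Fin d) ℂ) (VPoly d A) g) _
    (fun f hf s hs => by
      rw [Module.toModuleEnd_apply, DistribSMul.toLinearMap_apply, poly_smul_tmul]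
      exact tmul_mem_homPoly (hg.mul hf) hs) hq

theorem mulVal_mem_homPoly {S : Submodule ℂ A} {k : ℕ} {a : A} (ha : ∀ s ∈ S, a * s ∈ S)
    {q : VPoly d A} (hq : q ∈ homPoly d S k) : mulVal a q ∈ homPoly d S k :=
  map_mem_of_homPoly (mulVal a) _
    (fun f hf s hs => by
      rw [mulVal_tmul]
      exact tmul_mem_homPoly hf (ha s hs)) hq

/-- The truncated k - 1 is harmless: for k = 0 the derivative is zero. -/
theorem partialD_mem_homPoly {S : Submodule ℂ A} {k : ℕ} (i : Fin d)
    {q : VPoly d A} (hq : q ∈ homPoly d S k) : partialD i q ∈ homPoly d S (k - 1) :=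
  map_mem_of_homPoly (partialD i) _
    (fun f hf s hs => by
      rw [partialD_tmul]
      exact tmul_mem_homPoly hf.pderiv hs) hq

theorem eulerD_of_mem_homPoly {S : Submodule ℂ A} {k : ℕ}
    {q : VPoly d A} (hq : q ∈ homPoly d S k) : eulerD q = (k : ℂ) • q := by
  have h := map_mem_of_homPoly (∑ i, mulX i ∘ₗ partialD i - (k : ℂ) • LinearMap.id) ⊥
    (fun f hf s hs => by
      simp only [LinearMap.sub_apply, LinearMap.sum_apply, LinearMap.comp_apply, mulX_apply,
        partialD_tmul, poly_smul_tmul, LinearMap.smul_apply, LinearMap.id_apply,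
        ← TensorProduct.sum_tmul, Submodule.mem_bot, hf.sum_X_mul_pderiv]
      rw [TensorProduct.smul_tmul', Nat.cast_smul_eq_nsmul, sub_self]) hq
  simpa [eulerD, mulX_apply, sub_eq_zero] using h

end Calculus

/-! ### Clifford relations -/

section Frame

variable {d d' : ℕ} {A : Type} [Ring A]

/-- The Clifford relations `e_i e_j + e_j e_i = -2 δ_{ij}`. -/
def IsCliffordFrame (e : Fin d → A) : Prop :=
  ∀ i j, e i * e j + e j * e i = if i = j then (-2 : A) else 0

theorem IsCliffordFrame.anti {e : Fin d → A} (he : IsCliffordFrame e) {i j : Fin d} (h : i ≠ j) :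
    e i * e j = -(e j * e i) := by
  have := he i j
  rw [if_neg h] at this
  exact eq_neg_of_add_eq_zero_left this

theorem IsCliffordFrame.castSucc {e : Fin (d + 1) → A} (he : IsCliffordFrame e) :
    IsCliffordFrame (fun i : Fin d => e i.castSucc) := by
  intro i j
  simp only [he i.castSucc j.castSucc, Fin.castSucc_inj]

variable [Algebra ℂ A]

theorem IsCliffordFrame.sq {e : Fin d → A} (he : IsCliffordFrame e) (i : Fin d) :
    e i * e i = -1 := by
  have h := he i i
  rw [if_pos rfl, ← two_mul] at h
  have h2 : (2 : ℂ) • (e i * e i) = (2 : ℂ) • (-1 : A) := by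
    simpa [two_smul, ← two_mul] using h
  exact smul_right_injective A (two_ne_zero' ℂ) h2

/-- The number d' of variables is independent of the size d of the frame, because the first d
vectors must also act on polynomials in d + 1 variables. -/
theorem IsCliffordFrame.mul_anticomm_apply {e : Fin d → A} (he : IsCliffordFrame e) (i j : Fin d)
    (q : VPoly d' A) :
    mulVal (e i * e j) q + mulVal (e j * e i) q = if i = j then (-2 : ℂ) • q else 0 := by
  rw [← mulVal_add_left, he]
  split_ifs
  · rw [show (-2 : A) = (-2 : ℂ) • 1 by simp [← two_mul, neg_smul, two_smul],
      mulVal_smul_left, mulVal_one]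
  · rw [mulVal_zero_left]

/-- The contraction of `e_k e_l` with a symmetric tensor is minus its trace. -/
theorem IsCliffordFrame.sum_symm {e : Fin d → A} (he : IsCliffordFrame e)
    (F : Fin d → Fin d → VPoly d' A) (hF : ∀ k l, F k l = F l k) :
    ∑ k, ∑ l, mulVal (e k * e l) (F k l) = -∑ k, F k k := by
  have h1 : ∑ k, ∑ l, mulVal (e k * e l) (F k l) = ∑ k, ∑ l, mulVal (e l * e k) (F k l) := by
    rw [Finset.sum_comm]
    simp only [hF]
  have h2 : ∑ k, ∑ l, mulVal (e k * e l) (F k l) + ∑ k, ∑ l, mulVal (e l * e k) (F k l) =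
      (-2 : ℂ) • ∑ k, F k k := by
    simp only [← Finset.sum_add_distrib, he.mul_anticomm_apply, Finset.sum_ite_eq,
      Finset.mem_univ, if_true, Finset.smul_sum]
  rw [← h1, ← two_smul ℂ] at h2
  have h3 := congrArg (fun t => (1 / 2 : ℂ) • t) h2
  simp only [smul_smul] at h3
  norm_num at h3
  exact h3

end Frame

/-! ### The multiplier x̲ e_m and the operators in the first d variables -/

section X

variable {d : ℕ} {A : Type} [Ring A] [Algebra ℂ A] {e : Fin (d + 1) → A}

theorem xe_mul (e : Fin (d + 1) → A) (q : VPoly (d + 1) A) :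
    xe e * q = ∑ k : Fin d, (MvPolynomial.X k.castSucc : MvPolynomial (Fin (d + 1)) ℂ) •
      mulVal (e k.castSucc * e (Fin.last d)) q := by
  rw [xe, Finset.sum_mul]
  refine Finset.sum_congr rfl fun k _ => ?_
  rw [poly_smul_eq_mul, mulVal_apply, ← mul_assoc, Algebra.TensorProduct.tmul_mul_tmul, mul_one,
    one_mul]

theorem xe_mul_smul (f : MvPolynomial (Fin (d + 1)) ℂ) (q : VPoly (d + 1) A) :
    xe e * (f • q) = f • (xe e * q) := mul_smul_comm _ _ _

/-- Since e_m anticommutes with e_k and e_m² = -1, e_m e_k e_m = e_k. -/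
theorem castSucc_mul_last_sq (he : IsCliffordFrame e) (k : Fin d) (a : A) :
    a * e (Fin.last d) * (e k.castSucc * e (Fin.last d)) = a * e k.castSucc := by
  rw [he.anti (Fin.castSucc_lt_last k).ne, mul_neg, mul_assoc a, ← mul_assoc (e (Fin.last d)),
    he.sq]
  simp

theorem mulVal_last_xe_mul (he : IsCliffordFrame e) (q : VPoly (d + 1) A) :
    mulVal (e (Fin.last d)) (xe e * q) = ∑ k : Fin d,
      (MvPolynomial.X k.castSucc : MvPolynomial (Fin (d + 1)) ℂ) • mulVal (e k.castSucc) q := by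
  simp only [xe_mul, map_sum, mulVal_smul, mulVal_mulVal]
  refine Finset.sum_congr rfl fun k _ => ?_
  have := castSucc_mul_last_sq he k 1
  rw [one_mul, one_mul] at this
  rw [this]

/-- As e_m x̲ e_m = x̲, the square of x̲ e_m is x̲² = -(x_1² + ⋯ + x_d²) = -(r² - x_m²). -/
theorem xe_mul_xe_mul (he : IsCliffordFrame e) (q : VPoly (d + 1) A) :
    xe e * (xe e * q) = -((rSq d - MvPolynomial.X (Fin.last d) ^ 2) • q) := by
  have h := he.castSucc.sum_symm (fun k l => ((MvPolynomial.X k.castSucc *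
    MvPolynomial.X l.castSucc : MvPolynomial (Fin (d + 1)) ℂ)) • q) (fun k l => by rw [mul_comm])
  have hr : rSq d - MvPolynomial.X (Fin.last d) ^ 2 =
      ∑ k : Fin d, MvPolynomial.X k.castSucc * MvPolynomial.X k.castSucc := by
    rw [rSq, Fin.sum_univ_castSucc]
    simp only [add_sub_cancel_right, sq]
  rw [hr, Finset.sum_smul, ← h, xe_mul]
  refine Finset.sum_congr rfl fun k _ => ?_
  rw [xe_mul, map_sum, Finset.smul_sum]
  refine Finset.sum_congr rfl fun l _ => ?_
  rw [mulVal_smul, mulVal_smul, mulVal_mulVal, castSucc_mul_last_sq he, mul_smul]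

theorem partialD_last_xe_mul (q : VPoly (d + 1) A) :
    partialD (Fin.last d) (xe e * q) = xe e * partialD (Fin.last d) q := by
  simp only [xe_mul, map_sum, partialD_smul, partialD_mulVal]
  refine Finset.sum_congr rfl fun k _ => ?_
  rw [MvPolynomial.pderiv_X_of_ne (Fin.castSucc_lt_last k).ne, zero_smul, zero_add]

theorem partialD_castSucc_xe_mul (i : Fin d) (q : VPoly (d + 1) A) :
    partialD i.castSucc (xe e * q) =
      mulVal (e i.castSucc * e (Fin.last d)) q + xe e * partialD i.castSucc q := by
  simp only [xe_mul, map_sum, partialD_smul, partialD_mulVal, Finset.sum_add_distrib]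
  congr 1
  rw [Finset.sum_eq_single i]
  · rw [MvPolynomial.pderiv_X_self, one_smul]
  · intro b _ hb
    rw [MvPolynomial.pderiv_X_of_ne (by simpa using hb), zero_smul]
  · simp

/-- The Dirac operator in the first `d` variables. -/
noncomputable def lowerDirac (e : Fin (d + 1) → A) (q : VPoly (d + 1) A) : VPoly (d + 1) A :=
  ∑ k : Fin d, mulVal (e k.castSucc) (partialD k.castSucc q)

/-- The Euler operator in the first `d` variables. -/
noncomputable def lowerEuler (q : VPoly (d + 1) A) : VPoly (d + 1) A :=
  ∑ k : Fin d, (MvPolynomial.X k.castSucc : MvPolynomial (Fin (d + 1)) ℂ) • partialD k.castSucc q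

theorem dirac_eq_lowerDirac (q : VPoly (d + 1) A) :
    dirac e q = lowerDirac e q + mulVal (e (Fin.last d)) (partialD (Fin.last d) q) := by
  rw [dirac_apply, Fin.sum_univ_castSucc, lowerDirac]

theorem lowerDirac_add (p q : VPoly (d + 1) A) :
    lowerDirac e (p + q) = lowerDirac e p + lowerDirac e q := by
  simp only [lowerDirac, map_add, Finset.sum_add_distrib]

/-- A multiplier f with ∂_i f = x_i g contributes g x̲ q. Writing x̲ as e_m (x̲ e_m) keeps e_m as a
common left factor of all terms of the Dirac equation. -/
theorem lowerDirac_smul (f g : MvPolynomial (Fin (d + 1)) ℂ) (he : IsCliffordFrame e)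
    (hf : ∀ i : Fin d, MvPolynomial.pderiv i.castSucc f = MvPolynomial.X i.castSucc * g)
    (q : VPoly (d + 1) A) :
    lowerDirac e (f • q) = g • mulVal (e (Fin.last d)) (xe e * q) + f • lowerDirac e q := by
  rw [mulVal_last_xe_mul he]
  simp only [lowerDirac, partialD_smul, hf, map_add, mulVal_smul, Finset.sum_add_distrib,
    Finset.smul_sum, smul_smul, mul_comm g]

/-- With D the Dirac and E the Euler operator in d variables, this is the relation D x̲ + x̲ D = -(d
+ 2E), moved past e_m. -/
theorem lowerDirac_xe_mul (he : IsCliffordFrame e) (q : VPoly (d + 1) A) :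
    lowerDirac e (xe e * q) = xe e * lowerDirac e q -
      mulVal (e (Fin.last d)) ((d : ℂ) • q + (2 : ℂ) • lowerEuler q) := by
  have h1 : ∀ k : Fin d, mulVal (e k.castSucc) (mulVal (e k.castSucc * e (Fin.last d)) q) =
      -mulVal (e (Fin.last d)) q := by
    intro k
    rw [mulVal_mulVal, ← mul_assoc, he.sq, neg_one_mul, mulVal_neg_left]
  have h2 : ∀ k : Fin d, mulVal (e k.castSucc) (xe e * partialD k.castSucc q) =
      xe e * mulVal (e k.castSucc) (partialD k.castSucc q) - mulVal (e (Fin.last d))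
        ((2 : ℂ) • (MvPolynomial.X k.castSucc : MvPolynomial (Fin (d + 1)) ℂ) •
          partialD k.castSucc q) := by
    intro k
    set p := partialD k.castSucc q
    have h3 : ∀ l : Fin d, mulVal (e k.castSucc) ((MvPolynomial.X l.castSucc :
        MvPolynomial (Fin (d + 1)) ℂ) • mulVal (e l.castSucc * e (Fin.last d)) p) =
        (MvPolynomial.X l.castSucc : MvPolynomial (Fin (d + 1)) ℂ) •
          mulVal (e l.castSucc * e (Fin.last d)) (mulVal (e k.castSucc) p) +
        if k = l then (MvPolynomial.X l.castSucc : MvPolynomial (Fin (d + 1)) ℂ) •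
          (-2 : ℂ) • mulVal (e (Fin.last d)) p else 0 := by
      intro l
      have h4 := he.castSucc.mul_anticomm_apply k l (mulVal (e (Fin.last d)) p)
      rw [mulVal_mulVal, mulVal_mulVal] at h4
      rw [mulVal_smul, mulVal_mulVal, mulVal_mulVal, mul_assoc (e l.castSucc),
        he.anti (Fin.castSucc_lt_last k).ne', mul_neg, mulVal_neg_left, ← mul_assoc, ← mul_assoc,
        eq_sub_of_add_eq h4, smul_sub, smul_neg]
      split_ifs
      · abel
      · rw [smul_zero]
        abel
    rw [xe_mul, map_sum, xe_mul, Finset.sum_congr rfl fun l _ => h3 l, Finset.sum_add_distrib,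
      Finset.sum_ite_eq, if_pos (Finset.mem_univ k), LinearMap.map_smul, mulVal_smul,
      smul_comm _ (-2 : ℂ)]
    module
  rw [lowerDirac]
  simp only [partialD_castSucc_xe_mul, map_add, Finset.sum_add_distrib, h1, h2,
    Finset.sum_sub_distrib, ← Finset.mul_sum, ← map_sum]
  rw [lowerEuler, lowerDirac, Finset.smul_sum, Finset.sum_const, Finset.card_univ,
    Fintype.card_fin, LinearMap.map_smul, ← Nat.cast_smul_eq_nsmul ℂ]
  module

/-- A gradient parallel to x̲ is killed by the rotation fields x_j ∂_i - x_i ∂_j. -/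
theorem soAction_castSucc_smul (i j : Fin d) (f : MvPolynomial (Fin (d + 1)) ℂ)
    (g : MvPolynomial (Fin (d + 1)) ℂ)
    (hf : ∀ i : Fin d, MvPolynomial.pderiv i.castSucc f = MvPolynomial.X i.castSucc * g)
    (q : VPoly (d + 1) A) :
    soAction e i.castSucc j.castSucc (f • q) = f • soAction e i.castSucc j.castSucc q := by
  simp only [soAction_apply, partialD_smul, hf, mulVal_smul, ← C_smul_vpoly]
  module

/-- x̲ e_m is invariant under so(d): the commutator with e_i e_j / 2 cancels the rotation of the
coordinates of x̲. -/
theorem soAction_xe_mul (he : IsCliffordFrame e) (i j : Fin d) (q : VPoly (d + 1) A) :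
    soAction e i.castSucc j.castSucc (xe e * q) = xe e * soAction e i.castSucc j.castSucc q := by
  have h : mulVal (e i.castSucc * e j.castSucc) (xe e * q) =
      xe e * mulVal (e i.castSucc * e j.castSucc) q +
      (MvPolynomial.C 2 * MvPolynomial.X i.castSucc : MvPolynomial (Fin (d + 1)) ℂ) •
        mulVal (e j.castSucc * e (Fin.last d)) q -
      (MvPolynomial.C 2 * MvPolynomial.X j.castSucc : MvPolynomial (Fin (d + 1)) ℂ) •
        mulVal (e i.castSucc * e (Fin.last d)) q := by
    have h3 : ∀ k : Fin d, mulVal (e i.castSucc * e j.castSucc)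
        ((MvPolynomial.X k.castSucc : MvPolynomial (Fin (d + 1)) ℂ) •
          mulVal (e k.castSucc * e (Fin.last d)) q) =
        (MvPolynomial.X k.castSucc : MvPolynomial (Fin (d + 1)) ℂ) •
          mulVal (e k.castSucc * e (Fin.last d)) (mulVal (e i.castSucc * e j.castSucc) q) +
        (if i = k then (MvPolynomial.X k.castSucc : MvPolynomial (Fin (d + 1)) ℂ) •
          (2 : ℂ) • mulVal (e j.castSucc * e (Fin.last d)) q else 0) -
        if j = k then (MvPolynomial.X k.castSucc : MvPolynomial (Fin (d + 1)) ℂ) •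
          (2 : ℂ) • mulVal (e i.castSucc * e (Fin.last d)) q else 0 := by
      intro k
      have h4 := congrArg (mulVal (e i.castSucc))
        (he.castSucc.mul_anticomm_apply j k (mulVal (e (Fin.last d)) q))
      have h5 := he.castSucc.mul_anticomm_apply i k (mulVal (e j.castSucc * e (Fin.last d)) q)
      have h6 : e k.castSucc * e (Fin.last d) * (e i.castSucc * e j.castSucc) =
          e k.castSucc * e i.castSucc * (e j.castSucc * e (Fin.last d)) := by
        rw [mul_assoc, ← mul_assoc (e (Fin.last d)), he.anti (Fin.castSucc_lt_last i).ne',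
          neg_mul, mul_assoc (e i.castSucc), he.anti (Fin.castSucc_lt_last j).ne']
        simp only [mul_neg, neg_neg, mul_assoc]
      rw [map_add] at h4
      simp only [mulVal_mulVal] at h4 h5
      rw [mulVal_smul, mulVal_mulVal, mulVal_mulVal, h6]
      simp only [mul_assoc] at h4 h5 ⊢
      rw [eq_sub_of_add_eq h4, eq_sub_of_add_eq h5]
      split_ifs <;> simp only [mulVal_smul, mulVal_mulVal, ← C_smul_vpoly, map_zero, map_neg] <;>
        module
    rw [xe_mul, map_sum, xe_mul, Finset.sum_congr rfl fun l _ => h3 l, Finset.sum_sub_distrib,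
      Finset.sum_add_distrib, Finset.sum_ite_eq, Finset.sum_ite_eq, if_pos (Finset.mem_univ i),
      if_pos (Finset.mem_univ j)]
    simp only [← C_smul_vpoly]
    module
  simp only [soAction_apply, partialD_castSucc_xe_mul, h, mul_add, mul_sub, xe_mul_smul,
    ← C_smul_vpoly, smul_add, smul_sub, smul_smul, ← map_mul, ← mul_assoc]
  norm_num
  module

theorem mulVal_castSucc_last_xe_mul (he : IsCliffordFrame e) (i : Fin d) (q : VPoly (d + 1) A) :
    mulVal (e i.castSucc * e (Fin.last d)) (xe e * q) =
      -(xe e * mulVal (e i.castSucc * e (Fin.last d)) q) -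
      (MvPolynomial.C 2 * MvPolynomial.X i.castSucc : MvPolynomial (Fin (d + 1)) ℂ) • q := by
  have h3 : ∀ k : Fin d, mulVal (e i.castSucc * e (Fin.last d))
      ((MvPolynomial.X k.castSucc : MvPolynomial (Fin (d + 1)) ℂ) •
        mulVal (e k.castSucc * e (Fin.last d)) q) =
      -((MvPolynomial.X k.castSucc : MvPolynomial (Fin (d + 1)) ℂ) •
        mulVal (e k.castSucc * e (Fin.last d)) (mulVal (e i.castSucc * e (Fin.last d)) q)) -
      if i = k then (MvPolynomial.X k.castSucc : MvPolynomial (Fin (d + 1)) ℂ) • (2 : ℂ) • q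
        else 0 := by
    intro k
    have h5 := he.castSucc.mul_anticomm_apply i k q
    rw [mulVal_smul, mulVal_mulVal, mulVal_mulVal, castSucc_mul_last_sq he,
      castSucc_mul_last_sq he, eq_sub_of_add_eq h5]
    split_ifs
    · simp only [← C_smul_vpoly, map_neg]
      module
    · module
  rw [xe_mul, map_sum, xe_mul, Finset.sum_congr rfl fun l _ => h3 l, Finset.sum_sub_distrib,
    Finset.sum_ite_eq, if_pos (Finset.mem_univ i), Finset.sum_neg_distrib]
  simp only [← C_smul_vpoly]
  module

end X

/-! ### The polynomials X^{(n)}: Appell property, invariance, monogenicity, raising operator -/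

section GegenbauerX

variable {d : ℕ} {A : Type} [Ring A] [Algebra ℂ A] {e : Fin (d + 1) → A}

/-- The unnormalised polynomial `X^{(n)}` applied to `q`, with `ν = m / 2 + l - 1`. -/
noncomputable def gegenbauerX (e : Fin (d + 1) → A) (ν : ℂ) (n : ℤ) (q : VPoly (d + 1) A) :
    VPoly (d + 1) A :=
  gegenbauerInt d ν n • q +
    (MvPolynomial.C (2 * ν / (2 * ν + n)) * gegenbauerInt d (ν + 1) (n - 1)) • (xe e * q)

theorem gegenbauerX_zero (ν : ℂ) (q : VPoly (d + 1) A) : gegenbauerX e ν 0 q = q := by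
  rw [gegenbauerX, gegenbauerInt_zero, gegenbauerInt_of_neg _ _ (by omega)]
  module

theorem gegenbauerX_smul (ν : ℂ) (n : ℤ) (f : MvPolynomial (Fin (d + 1)) ℂ)
    (q : VPoly (d + 1) A) : gegenbauerX e ν n (f • q) = f • gegenbauerX e ν n q := by
  rw [gegenbauerX, gegenbauerX, xe_mul_smul]
  module

theorem gegenbauerX_C_smul (ν : ℂ) (n : ℤ) (c : ℂ)
    (q : VPoly (d + 1) A) : gegenbauerX e ν n (c • q) = c • gegenbauerX e ν n q := by
  rw [← C_smul_vpoly, gegenbauerX_smul, C_smul_vpoly]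

/-- `X^{(n)}` is an Appell sequence. -/
theorem partialD_last_gegenbauerX (ν : ℂ) (n : ℤ) (h1 : 2 * ν + n ≠ 0) (h2 : 2 * ν + n - 1 ≠ 0)
    (q : VPoly (d + 1) A) (hq : partialD (Fin.last d) q = 0) :
    partialD (Fin.last d) (gegenbauerX e ν n q) =
      (2 * ν + n - 1) • gegenbauerX e ν (n - 1) q := by
  -- Differentiating C^{ν+1}_{n-1} produces the factor 2(ν+1) + (n-1) - 1 = 2ν + n, which cancels
  -- the denominator; both sides equal 2ν.
  have hc : 2 * ν / (2 * ν + n) * (2 * (ν + 1) + (n - 1 : ℤ) - 1) =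
      (2 * ν + n - 1) * (2 * ν / (2 * ν + (n - 1 : ℤ))) := by
    have h3 : 2 * ν + ((n - 1 : ℤ) : ℂ) ≠ 0 := by
      push_cast
      rwa [← add_sub_assoc]
    push_cast at h3 ⊢
    field_simp
    ring
  have hc' := congrArg (MvPolynomial.C (σ := Fin (d + 1))) hc
  rw [map_mul, map_mul] at hc'
  simp only [gegenbauerX, map_add, partialD_smul, hq, partialD_last_xe_mul,
    pderiv_last_gegenbauerInt, MvPolynomial.pderiv_C_mul, mul_zero, smul_zero, add_zero,
    ← C_smul_vpoly, ← mul_assoc, hc']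
  module

theorem pderiv_castSucc_gegenbauerInt' (ν : ℂ) (n : ℤ) (i : Fin d) :
    MvPolynomial.pderiv i.castSucc (gegenbauerInt d ν n) =
      MvPolynomial.X i.castSucc * (-(MvPolynomial.C (2 * ν) * gegenbauerInt d (ν + 1) (n - 2))) := by
  rw [pderiv_castSucc_gegenbauerInt]
  ring

theorem soAction_gegenbauerX (he : IsCliffordFrame e) (ν : ℂ) (n : ℤ) (i j : Fin d)
    (q : VPoly (d + 1) A) :
    soAction e i.castSucc j.castSucc (gegenbauerX e ν n q) =
      gegenbauerX e ν n (soAction e i.castSucc j.castSucc q) := by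
  rw [gegenbauerX, map_add,
    soAction_castSucc_smul i j _ _ (pderiv_castSucc_gegenbauerInt' ν n) q, mul_smul,
    C_smul_vpoly, LinearMap.map_smul,
    soAction_castSucc_smul i j _ _ (pderiv_castSucc_gegenbauerInt' (ν + 1) (n - 1)),
    soAction_xe_mul he, gegenbauerX, mul_smul, C_smul_vpoly]

/-- The choice of ν makes d + 2E act on q as 2ν + 1, so every term of the Dirac operator is a
multiple of e_m q or of e_m x̲ e_m q. The second coefficient is -2ν + 2ν times C^{ν+1}_{n-2}; the
first vanishes by `gegenbauerInt_dirac_identity` and the recurrence, both in degree n - 1. -/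
theorem dirac_gegenbauerX (he : IsCliffordFrame e) (ν : ℂ) (l : ℂ) (hν : 2 * ν = d + 2 * l - 1)
    (n : ℤ) (h1 : 2 * ν + n ≠ 0) (h2 : 2 * ν + n - 1 ≠ 0)
    (q : VPoly (d + 1) A) (hq : partialD (Fin.last d) q = 0) (hD : lowerDirac e q = 0)
    (hE : lowerEuler q = l • q) :
    dirac e (gegenbauerX e ν n q) = 0 := by
  have hβ : 2 * ν / (2 * ν + n) * (2 * ν + n) = 2 * ν := div_mul_cancel₀ _ h1
  have hβ' : 2 * ν / (2 * ν + (n - 1 : ℤ)) * (2 * ν + n - 1) = 2 * ν := by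
    push_cast
    rw [← add_sub_assoc]
    exact div_mul_cancel₀ _ h2
  have hl : lowerDirac e (xe e * q) =
      -(MvPolynomial.C (2 * ν + 1) : MvPolynomial (Fin (d + 1)) ℂ) • mulVal (e (Fin.last d)) q := by
    rw [lowerDirac_xe_mul he, hD, hE, hν]
    simp only [← C_smul_vpoly, map_add, mulVal_smul, map_mul, map_sub, mul_zero, map_one]
    module
  have hf : ∀ i : Fin d, MvPolynomial.pderiv i.castSucc
      (MvPolynomial.C (2 * ν / (2 * ν + n)) * gegenbauerInt d (ν + 1) (n - 1)) =
      MvPolynomial.X i.castSucc * (-(MvPolynomial.C (2 * ν / (2 * ν + n)) *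
        (MvPolynomial.C (2 * (ν + 1)) * gegenbauerInt d (ν + 2) (n - 1 - 2)))) := by
    intro i
    rw [MvPolynomial.pderiv_C_mul, pderiv_castSucc_gegenbauerInt', add_assoc ν,
      one_add_one_eq_two]
    ring
  rw [dirac_eq_lowerDirac, partialD_last_gegenbauerX ν n h1 h2 q hq]
  rw [gegenbauerX, lowerDirac_add, lowerDirac_smul _ _ he hf, hl,
    lowerDirac_smul _ _ he (pderiv_castSucc_gegenbauerInt' ν n), hD, xe_mul_xe_mul he, gegenbauerX,
    ← C_smul_vpoly, map_neg (mulVal _), mulVal_smul, mulVal_smul,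
    map_add (mulVal _), mulVal_smul, mulVal_smul]
  generalize mulVal (e (Fin.last d)) q = u
  generalize mulVal (e (Fin.last d)) (xe e * q) = v
  have hI := gegenbauerInt_dirac_identity d ν (n - 1)
  have hR := two_mul_add_gegenbauerInt d ν (n - 1)
  rw [show (2 * ν + ((n - 1 : ℤ) : ℂ) + 1) = 2 * ν + n by push_cast; ring] at hI
  rw [show (2 * ν + ((n - 1 : ℤ) : ℂ)) = 2 * ν + n - 1 by push_cast; ring] at hR
  have hC := congrArg (MvPolynomial.C (σ := Fin (d + 1))) hβ
  have hC' := congrArg (MvPolynomial.C (σ := Fin (d + 1))) hβ'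
  rw [map_mul] at hC hC'
  rw [show n - 1 - 1 = n - 2 by ring] at *
  linear_combination (norm := module)
    ((-MvPolynomial.C (2 * ν / (2 * ν + n)) : MvPolynomial (Fin (d + 1)) ℂ) * hI + hR - hC * (gegenbauerInt d (ν + 1) (n - 1) -
      (MvPolynomial.X (Fin.last d) : MvPolynomial (Fin (d + 1)) ℂ) * gegenbauerInt d (ν + 1) (n - 2))) • u +
    (hC' * gegenbauerInt d (ν + 1) (n - 2)) • v

/-- The hypotheses on q make the terms in ∂_i q and e_i e_m q cancel against those of index j. What
remains is divisible by z = x_i - i x_j; since z q has one more degree than q, its multiplier has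
index ν + 1. -/
theorem raising_gegenbauerX (he : IsCliffordFrame e) (ν : ℂ) (n : ℤ)
    (h1 : 2 * ν + n ≠ 0) (h2 : 2 * ν + n - 1 ≠ 0) (h3 : 2 * ν + n + 1 ≠ 0) (i j : Fin d)
    (q : VPoly (d + 1) A) (hq : partialD (Fin.last d) q = 0)
    (hz : partialD i.castSucc q = Complex.I • partialD j.castSucc q)
    (hg : mulVal (e i.castSucc * e (Fin.last d)) q =
      Complex.I • mulVal (e j.castSucc * e (Fin.last d)) q) :
    soAction e i.castSucc (Fin.last d) (gegenbauerX e ν n q) -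
      Complex.I • soAction e j.castSucc (Fin.last d) (gegenbauerX e ν n q) =
    -(2 * ν * (2 * ν + n + 1) / (2 * ν + n)) • gegenbauerX e (ν + 1) (n - 1)
      ((MvPolynomial.X i.castSucc - MvPolynomial.C Complex.I * MvPolynomial.X j.castSucc :
        MvPolynomial (Fin (d + 1)) ℂ) • q) := by
  have hβ : 2 * ν / (2 * ν + n) * (2 * ν + n) = 2 * ν := div_mul_cancel₀ _ h1
  have hβ' : 2 * ν / (2 * ν + (n - 1 : ℤ)) * (2 * ν + n - 1) = 2 * ν := by
    push_cast
    rw [← add_sub_assoc]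
    exact div_mul_cancel₀ _ h2
  -- The coefficient of z q: 2ν/(2ν+n) comes from the spin part and 2ν from the rotation part. The
  -- identity `hγ'` matches the coefficient of z x̲ e_m q.
  have hγ : 2 * ν / (2 * ν + n) + 2 * ν = 2 * ν * (2 * ν + n + 1) / (2 * ν + n) := by
    field_simp
    ring
  have hγ' : 2 * ν * (2 * ν + n + 1) / (2 * ν + n) *
      (2 * (ν + 1) / (2 * (ν + 1) + (n - 1 : ℤ))) = 2 * ν / (2 * ν + n) * (2 * (ν + 1)) := by
    have h4 : 2 * (ν + 1) + ((n - 1 : ℤ) : ℂ) = 2 * ν + n + 1 := by push_cast; ring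
    rw [h4]
    field_simp
  have hR := two_mul_add_gegenbauerInt d ν (n - 1)
  rw [show (2 * ν + ((n - 1 : ℤ) : ℂ)) = 2 * ν + n - 1 by push_cast; ring] at hR
  have hS := two_mul_add_gegenbauerInt d (ν + 1) (n - 2)
  rw [show (2 * (ν + 1) + ((n - 2 : ℤ) : ℂ)) = 2 * ν + n by push_cast; ring] at hS
  have hC := congrArg (MvPolynomial.C (σ := Fin (d + 1))) hβ
  have hC' := congrArg (MvPolynomial.C (σ := Fin (d + 1))) hβ'
  have hD := congrArg (MvPolynomial.C (σ := Fin (d + 1))) hγ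
  have hD' := congrArg (MvPolynomial.C (σ := Fin (d + 1))) hγ'
  have h12 : (MvPolynomial.C (1 / 2) * MvPolynomial.C 2 : MvPolynomial (Fin (d + 1)) ℂ) = 1 := by
    rw [← map_mul]
    norm_num
  rw [map_mul] at hC hC' hD'
  rw [map_mul _ (2 * ν / (2 * ν + n))] at hD'
  rw [map_add] at hD
  simp only [soAction_apply, partialD_last_gegenbauerX ν n h1 h2 q hq]
  simp only [gegenbauerX, map_add (mulVal _), map_add (partialD _), partialD_smul,
    partialD_castSucc_xe_mul, mulVal_smul,
    mulVal_castSucc_last_xe_mul he, pderiv_castSucc_gegenbauerInt', MvPolynomial.pderiv_C_mul, hz,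
    hg, xe_mul_smul, ← C_smul_vpoly, map_neg MvPolynomial.C]
  generalize mulVal (e j.castSucc * e (Fin.last d)) q = u
  generalize partialD j.castSucc q = v
  generalize xe e * q = y
  rw [show n - 1 - 1 = n - 2 by ring, show n - 2 - 1 = n - 3 by ring,
    show n - 1 - 2 = n - 3 by ring] at *
  linear_combination (norm := module)
    ((MvPolynomial.X i.castSucc - MvPolynomial.C Complex.I * MvPolynomial.X j.castSucc :
        MvPolynomial (Fin (d + 1)) ℂ) *
      (-(MvPolynomial.C (2 * ν / (2 * ν + n)) * gegenbauerInt d (ν + 1) (n - 1)) * h12 - hR -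
        gegenbauerInt d (ν + 1) (n - 1) * hD)) • q +
    ((MvPolynomial.X i.castSucc - MvPolynomial.C Complex.I * MvPolynomial.X j.castSucc :
        MvPolynomial (Fin (d + 1)) ℂ) *
      (-gegenbauerInt d (ν + 1) (n - 2) * hC' + gegenbauerInt d (ν + 1 + 1) (n - 2) * hD' +
        gegenbauerInt d (ν + 1) (n - 2) * hC -
        (MvPolynomial.C (2 * ν / (2 * ν + n)) : MvPolynomial (Fin (d + 1)) ℂ) * hS)) • y

end GegenbauerX

/-! ### The Casimir operator on spherical monogenics -/

section Casimir

variable {d : ℕ} {A : Type} [Ring A] [Algebra ℂ A] {e : Fin d → A}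

/-- Twice the Casimir operator of `so(d)`, up to a constant. -/
noncomputable def casimirSum {m : ℕ} {M : Type*} [AddCommGroup M] [Module ℂ M]
    (T : Fin m → Fin m → Module.End ℂ M) {ι : Type*} [Fintype ι] (σ : ι → Fin m) :
    Module.End ℂ M :=
  ∑ i, ∑ j, T (σ i) (σ j) ∘ₗ T (σ i) (σ j)

/-- The scalar by which the Casimir sum acts on spherical monogenics of degree `l`. -/
noncomputable def casimirScalar (d l : ℕ) : ℝ :=
  (2 * d - d ^ 2) / 4 - 2 * l * (l + d - 1)

theorem casimirScalar_injective (hd : 1 ≤ d) : Function.Injective (casimirScalar d) := by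
  intro a b h
  have hd' : (1 : ℝ) ≤ d := by exact_mod_cast hd
  simp only [casimirScalar] at h
  have h1 : ((a : ℝ) - b) * (a + b + d - 1) = 0 := by linarith
  rcases mul_eq_zero.1 h1 with h2 | h2
  · exact_mod_cast sub_eq_zero.1 h2
  · have ha : (0 : ℝ) ≤ a := Nat.cast_nonneg a
    have hb : (0 : ℝ) ≤ b := Nat.cast_nonneg b
    have ha0 : (a : ℝ) = 0 := by linarith
    have hb0 : (b : ℝ) = 0 := by linarith
    exact_mod_cast ha0.trans hb0.symm

theorem soAction_self (he : IsCliffordFrame e) (i : Fin d) (q : VPoly d A) :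
    soAction e i i q = -(1 / 2 : ℂ) • q := by
  rw [soAction_apply, he.sq, mulVal_neg_left, mulVal_one]
  module

theorem soAction_swap (he : IsCliffordFrame e) {i j : Fin d} (h : i ≠ j) (q : VPoly d A) :
    soAction e j i q = -soAction e i j q := by
  rw [soAction_apply, soAction_apply, he.anti h.symm, mulVal_neg_left]
  module

/-- The rotation vector field `x_j ∂_i - x_i ∂_j`. -/
noncomputable def rotationD (i j : Fin d) : Module.End ℂ (VPoly d A) :=
  mulX j ∘ₗ partialD i - mulX i ∘ₗ partialD j

theorem rotationD_apply (i j : Fin d) (q : VPoly d A) :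
    rotationD i j q = (MvPolynomial.X j : MvPolynomial (Fin d) ℂ) • partialD i q -
      (MvPolynomial.X i : MvPolynomial (Fin d) ℂ) • partialD j q := by
  simp only [rotationD, LinearMap.sub_apply, LinearMap.comp_apply, mulX_apply]

theorem soAction_eq_rotationD (i j : Fin d) (q : VPoly d A) :
    soAction e i j q = (1 / 2 : ℂ) • mulVal (e i * e j) q + rotationD i j q := by
  rw [soAction_apply, rotationD_apply]
  abel

theorem rotationD_mulVal (i j : Fin d) (a : A) (q : VPoly d A) :
    rotationD i j (mulVal a q) = mulVal a (rotationD i j q) := by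
  simp only [rotationD_apply, partialD_mulVal, map_sub, mulVal_smul]

/-- The square of the Dirac operator is minus the Laplacian. -/
theorem laplacian_eq_zero (he : IsCliffordFrame e) {q : VPoly d A} (hq : dirac e q = 0) :
    ∑ i, partialD i (partialD i q) = 0 := by
  have h := he.sum_symm (fun i j => partialD i (partialD j q)) (fun i j => partialD_comm i j q)
  rw [← neg_eq_zero, ← h]
  have h2 : dirac e (dirac e q) = 0 := by rw [hq, map_zero]
  rw [← h2, dirac_apply]
  refine Finset.sum_congr rfl fun i _ => ?_
  rw [dirac_apply, map_sum, map_sum]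
  refine Finset.sum_congr rfl fun j _ => ?_
  rw [partialD_mulVal, mulVal_mulVal]

/-- The sum of e_i e_j x_i ∂_j is x̲ times the Dirac operator and vanishes on q. Exchanging e_i and
e_j in the other sum leaves only the trace, -2 times the Euler operator. -/
theorem sum_mulVal_rotation (he : IsCliffordFrame e) {q : VPoly d A} (hq : dirac e q = 0) :
    ∑ i, ∑ j, mulVal (e i * e j) (rotationD i j q) = (-2 : ℂ) • eulerD q := by
  have h1 : ∑ i, ∑ j, mulVal (e i * e j)
      ((MvPolynomial.X i : MvPolynomial (Fin d) ℂ) • partialD j q) = 0 := by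
    refine Finset.sum_eq_zero fun i _ => ?_
    simp only [mulVal_smul, ← mulVal_mulVal, ← Finset.smul_sum, ← map_sum]
    rw [← dirac_apply, hq, map_zero, smul_zero]
  have h2 : ∑ i, ∑ j, mulVal (e i * e j)
      ((MvPolynomial.X j : MvPolynomial (Fin d) ℂ) • partialD i q) = (-2 : ℂ) • eulerD q := by
    have h3 : ∀ i j, mulVal (e i * e j)
        ((MvPolynomial.X j : MvPolynomial (Fin d) ℂ) • partialD i q) =
        (if i = j then (-2 : ℂ) • ((MvPolynomial.X j : MvPolynomial (Fin d) ℂ) • partialD i q)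
          else 0) - mulVal (e j * e i)
            ((MvPolynomial.X j : MvPolynomial (Fin d) ℂ) • partialD i q) := fun i j =>
      eq_sub_of_add_eq (he.mul_anticomm_apply i j _)
    simp only [h3, Finset.sum_sub_distrib, Finset.sum_ite_eq, Finset.mem_univ, if_true]
    rw [Finset.sum_comm, h1, sub_zero, eulerD, Finset.smul_sum]
  simp only [rotationD_apply, map_sub, Finset.sum_sub_distrib, h1, h2, sub_zero]

/-- This is half of the sum of the squared rotation fields: by antisymmetry both halves of each
square contribute equally. On a harmonic q the term r²Δ drops out and powers of the Euler operator E
remain. -/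
theorem sum_rotation_sq {q : VPoly d A} (l : ℂ) (hE : eulerD q = l • q)
    (hΔ : ∑ i, partialD i (partialD i q) = 0) :
    ∑ i, ∑ j, (MvPolynomial.X j : MvPolynomial (Fin d) ℂ) • partialD i (rotationD i j q) =
    (-(l * (l + d - 2))) • q := by
  have hEE : ∑ i, ∑ j, (MvPolynomial.X i * MvPolynomial.X j : MvPolynomial (Fin d) ℂ) •
      partialD i (partialD j q) = (l ^ 2 - l) • q := by
    have h1 : eulerD (eulerD q) = (l ^ 2) • q := by
      rw [hE]
      simp only [eulerD, LinearMap.map_smul, smul_comm _ l, ← Finset.smul_sum]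
      rw [← eulerD, hE, smul_smul, sq]
    have h2 : eulerD (eulerD q) = eulerD q + ∑ i, ∑ j,
        (MvPolynomial.X i * MvPolynomial.X j : MvPolynomial (Fin d) ℂ) •
          partialD i (partialD j q) := by
      simp only [eulerD, map_sum, partialD_smul, Finset.sum_add_distrib, smul_add,
        MvPolynomial.pderiv_X, Pi.single_apply, ite_smul, one_smul, zero_smul,
        Finset.smul_sum, smul_smul]
      simp
    rw [h1, hE] at h2
    linear_combination (norm := module) -h2
  have hE' : ∑ j, (MvPolynomial.X j : MvPolynomial (Fin d) ℂ) • partialD j q = l • q := hE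
  have hr : ∑ i, ∑ j, (MvPolynomial.X j * MvPolynomial.X j : MvPolynomial (Fin d) ℂ) •
      partialD i (partialD i q) = 0 := by
    rw [Finset.sum_comm]
    simp only [← Finset.smul_sum, hΔ, smul_zero, Finset.sum_const_zero]
  have key : ∀ i j, (MvPolynomial.X j : MvPolynomial (Fin d) ℂ) • partialD i (rotationD i j q) =
      (if i = j then (MvPolynomial.X j : MvPolynomial (Fin d) ℂ) • partialD i q else 0) +
      (MvPolynomial.X j * MvPolynomial.X j : MvPolynomial (Fin d) ℂ) •
        partialD i (partialD i q) -
      (MvPolynomial.X j : MvPolynomial (Fin d) ℂ) • partialD j q -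
      (MvPolynomial.X i * MvPolynomial.X j : MvPolynomial (Fin d) ℂ) •
          partialD i (partialD j q) := by
    intro i j
    rw [rotationD_apply, map_sub, partialD_smul, partialD_smul, MvPolynomial.pderiv_X_self, MvPolynomial.pderiv_X,
      Pi.single_apply]
    split_ifs with h1 h2 h2
    · module
    · exact absurd h1.symm h2
    · exact absurd h2.symm h1
    · module
  simp only [key, Finset.sum_sub_distrib, Finset.sum_add_distrib, Finset.sum_ite_eq,
    Finset.mem_univ, if_true, hEE, hE', hr, Finset.sum_const, Finset.card_univ, Fintype.card_fin]
  rw [← Nat.cast_smul_eq_nsmul ℂ]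
  module

/-- Expanding (½ e_i e_j + L_ij)², L_ij the rotation field: the spin squares give (2d - d²)/4, the
cross terms -2l, and the L_ij² give -2l(l + d - 2). -/
theorem casimirSum_monogenics (he : IsCliffordFrame e) {S : Submodule ℂ A} {l : ℕ} {q : VPoly d A}
    (hq : q ∈ monogenics e S l) :
    casimirSum (soAction e) id q = ((casimirScalar d l : ℝ) : ℂ) • q := by
  have hE := eulerD_of_mem_homPoly hq.1
  have hD : dirac e q = 0 := hq.2
  have h1 := sum_rotation_sq l hE (laplacian_eq_zero he hD)
  have h2 := sum_mulVal_rotation he hD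
  have h3 : ∑ i, ∑ j, mulVal (e i * e j * (e i * e j)) q = (2 * d - (d : ℂ) ^ 2) • q := by
    have h4 : ∀ i j, mulVal (e i * e j * (e i * e j)) q =
        (if i = j then (2 : ℂ) • q else 0) - q := by
      intro i j
      split_ifs with h
      · rw [h, he.sq, neg_mul_neg, one_mul, mulVal_one]
        module
      · rw [mul_assoc, ← mul_assoc (e j), he.anti (Ne.symm h), neg_mul, mul_assoc (e i), he.sq,
          mul_neg_one, neg_neg, he.sq, mulVal_neg_left, mulVal_one]
        module
    simp only [h4, Finset.sum_sub_distrib, Finset.sum_ite_eq, Finset.mem_univ, if_true,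
      Finset.sum_const, Finset.card_univ, Fintype.card_fin]
    simp only [← Nat.cast_smul_eq_nsmul ℂ]
    module
  have key : ∀ i j, soAction e i j (soAction e i j q) =
      (1 / 4 : ℂ) • mulVal (e i * e j * (e i * e j)) q + mulVal (e i * e j) (rotationD i j q) +
      ((MvPolynomial.X j : MvPolynomial (Fin d) ℂ) • partialD i (rotationD i j q) +
      (MvPolynomial.X i : MvPolynomial (Fin d) ℂ) • partialD j (rotationD j i q)) := by
    intro i j
    have h4 : rotationD i j (rotationD i j q) =
        (MvPolynomial.X j : MvPolynomial (Fin d) ℂ) • partialD i (rotationD i j q) +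
        (MvPolynomial.X i : MvPolynomial (Fin d) ℂ) • partialD j (rotationD j i q) := by
      have h5 : rotationD j i q = -rotationD i j q := by
        rw [rotationD_apply, rotationD_apply]
        abel
      rw [rotationD_apply i j (rotationD i j q), h5, map_neg]
      module
    rw [← h4, soAction_eq_rotationD, soAction_eq_rotationD, map_add, map_add, LinearMap.map_smul,
      LinearMap.map_smul, mulVal_mulVal, rotationD_mulVal]
    module
  have h5 : ∑ i, ∑ j, (MvPolynomial.X i : MvPolynomial (Fin d) ℂ) • partialD j (rotationD j i q) =
      (-(l * (l + d - 2)) : ℂ) • q := by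
    rw [Finset.sum_comm]
    exact h1
  have h6 : ∑ i, ∑ j, (1 / 4 : ℂ) • mulVal (e i * e j * (e i * e j)) q =
      (1 / 4 : ℂ) • (2 * d - (d : ℂ) ^ 2) • q := by
    simp only [← Finset.smul_sum, h3]
  simp only [casimirSum, LinearMap.sum_apply, LinearMap.comp_apply, id, key,
    Finset.sum_add_distrib]
  rw [h1, h2, h5, h6, hE, casimirScalar]
  push_cast
  module

end Casimir

/-! ### Adding and removing the last variable -/

section Extend

variable {d : ℕ} {A : Type} [Ring A] [Algebra ℂ A] {e : Fin (d + 1) → A}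

theorem extendVar_tmul (f : MvPolynomial (Fin d) ℂ) (a : A) :
    extendVar (f ⊗ₜ[ℂ] a) = (MvPolynomial.rename Fin.castSucc f) ⊗ₜ[ℂ] a := rfl

theorem extendVar_smul (f : MvPolynomial (Fin d) ℂ) (p : VPoly d A) :
    extendVar (f • p) = (MvPolynomial.rename Fin.castSucc f) • extendVar p := by
  induction p using TensorProduct.induction_on with
  | zero => simp
  | tmul g a => rw [poly_smul_tmul, extendVar_tmul, extendVar_tmul, poly_smul_tmul, map_mul]
  | add x y hx hy => rw [smul_add, map_add, hx, hy, map_add, smul_add]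

theorem extendVar_mulVal (a : A) (p : VPoly d A) :
    extendVar (mulVal a p) = mulVal a (extendVar p) := by
  induction p using TensorProduct.induction_on with
  | zero => simp
  | tmul g b => rw [mulVal_tmul, extendVar_tmul, extendVar_tmul, mulVal_tmul]
  | add x y hx hy => rw [map_add, map_add, hx, hy, map_add, map_add]

theorem partialD_castSucc_extendVar (i : Fin d) (p : VPoly d A) :
    partialD i.castSucc (extendVar p) = extendVar (partialD i p) := by
  induction p using TensorProduct.induction_on with
  | zero => simp
  | tmul g b =>
    rw [partialD_tmul, extendVar_tmul, extendVar_tmul, partialD_tmul,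
      MvPolynomial.pderiv_rename (Fin.castSucc_injective d)]
  | add x y hx hy => simp only [map_add, hx, hy]

theorem partialD_last_extendVar (p : VPoly d A) :
    partialD (Fin.last d) (extendVar p) = 0 := by
  induction p using TensorProduct.induction_on with
  | zero => simp
  | tmul g b =>
    rw [extendVar_tmul, partialD_tmul, MvPolynomial.pderiv_eq_zero_of_notMem_vars,
      TensorProduct.zero_tmul]
    intro h
    have h1 := MvPolynomial.vars_rename _ _ h
    simp only [Finset.mem_image] at h1
    obtain ⟨i, _, hi⟩ := h1
    exact (Fin.castSucc_lt_last i).ne hi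
  | add x y hx hy => simp only [map_add, hx, hy, add_zero]

theorem soAction_extendVar (i j : Fin d) (p : VPoly d A) :
    soAction e i.castSucc j.castSucc (extendVar p) =
      extendVar (soAction (fun i : Fin d => e i.castSucc) i j p) := by
  simp only [soAction_apply, map_add, map_sub, LinearMap.map_smul, extendVar_smul, extendVar_mulVal,
    partialD_castSucc_extendVar, MvPolynomial.rename_X]

theorem lowerDirac_extendVar (p : VPoly d A) :
    lowerDirac e (extendVar p) = extendVar (dirac (fun i : Fin d => e i.castSucc) p) := by
  simp only [lowerDirac, dirac_apply, map_sum, extendVar_mulVal, partialD_castSucc_extendVar]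

theorem lowerEuler_extendVar (p : VPoly d A) :
    lowerEuler (extendVar p) = extendVar (eulerD p) := by
  simp only [lowerEuler, eulerD, map_sum, extendVar_smul, partialD_castSucc_extendVar,
    MvPolynomial.rename_X]

theorem extendVar_mem_homPoly {S : Submodule ℂ A} {k : ℕ} {p : VPoly d A}
    (hp : p ∈ homPoly d S k) : extendVar p ∈ homPoly (d + 1) S k :=
  map_mem_of_homPoly extendVar _
    (fun f hf s hs => by
      rw [extendVar_tmul]
      exact tmul_mem_homPoly hf.rename_isHomogeneous hs) hp

/-- Setting `x_{d+1} = 0` in polynomials. -/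
noncomputable def restrictPoly (d : ℕ) : MvPolynomial (Fin (d + 1)) ℂ →ₐ[ℂ] MvPolynomial (Fin d) ℂ :=
  MvPolynomial.aeval (Fin.snoc (α := fun _ => MvPolynomial (Fin d) ℂ) MvPolynomial.X 0)

/-- Setting `x_{d+1} = 0`. -/
noncomputable def restrictVar : VPoly (d + 1) A →ₗ[ℂ] VPoly d A :=
  LinearMap.rTensor A (restrictPoly d).toLinearMap

theorem restrictVar_extendVar (p : VPoly d A) : restrictVar (extendVar p) = p := by
  induction p using TensorProduct.induction_on with
  | zero => simp
  | tmul g b =>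
    change (restrictPoly d (MvPolynomial.rename Fin.castSucc g)) ⊗ₜ[ℂ] b = _
    rw [restrictPoly, MvPolynomial.aeval_rename]
    congr 1
    convert MvPolynomial.aeval_X_left_apply g
    ext i
    simp
  | add x y hx hy => simp only [map_add, hx, hy]

theorem extendVar_injective : Function.Injective (extendVar : VPoly d A →ₗ[ℂ] VPoly (d + 1) A) :=
  Function.LeftInverse.injective restrictVar_extendVar

theorem restrictVar_mem_homPoly {S : Submodule ℂ A} {k : ℕ} {p : VPoly (d + 1) A}
    (hp : p ∈ homPoly (d + 1) S k) : restrictVar p ∈ homPoly d S k :=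
  map_mem_of_homPoly restrictVar _
    (fun f hf s hs => by
      change (restrictPoly d f) ⊗ₜ[ℂ] s ∈ _
      refine tmul_mem_homPoly ?_ hs
      have h := hf.aeval (n := 1) (Fin.snoc (α := fun _ => MvPolynomial (Fin d) ℂ) MvPolynomial.X 0) (by
        intro i
        refine Fin.lastCases ?_ (fun i => ?_) i
        · simpa using MvPolynomial.isHomogeneous_zero (Fin d) ℂ 1
        · simpa using MvPolynomial.isHomogeneous_X ℂ i)
      rwa [one_mul] at h) hp

/-- The antiderivative in the last variable that vanishes at `x_{d+1} = 0`. -/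
noncomputable def antiderivLast (d : ℕ) :
    MvPolynomial (Fin (d + 1)) ℂ →ₗ[ℂ] MvPolynomial (Fin (d + 1)) ℂ :=
  (MvPolynomial.basisMonomials (Fin (d + 1)) ℂ).constr ℂ fun s =>
    MvPolynomial.monomial (s + Finsupp.single (Fin.last d) 1) (1 / ((s (Fin.last d) : ℂ) + 1))

/-- The fundamental theorem of calculus in x_m: the integral from 0 of ∂_m g, plus the value of g at
x_m = 0, is g. -/
theorem antiderivLast_pderiv_monomial (s : Fin (d + 1) →₀ ℕ) :
    antiderivLast d (MvPolynomial.pderiv (Fin.last d) (MvPolynomial.monomial s (1 : ℂ))) +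
      MvPolynomial.rename Fin.castSucc (restrictPoly d (MvPolynomial.monomial s 1)) =
    MvPolynomial.monomial s 1 := by
  -- The factor `0 ^ s (Fin.last d)` is 1 exactly when x_m does not occur in the monomial.
  have hr : MvPolynomial.rename Fin.castSucc (restrictPoly d (MvPolynomial.monomial s 1)) =
      0 ^ s (Fin.last d) * ∏ i : Fin d,
        (MvPolynomial.X i.castSucc : MvPolynomial (Fin (d + 1)) ℂ) ^ s i.castSucc := by
    rw [restrictPoly, MvPolynomial.aeval_monomial, Finsupp.prod_fintype _ _ (by simp),
      Fin.prod_univ_castSucc]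
    simp [mul_comm]
  rw [hr, MvPolynomial.pderiv_monomial]
  rcases Nat.eq_zero_or_pos (s (Fin.last d)) with h | h
  · rw [h]
    simp only [Nat.cast_zero, mul_zero, map_zero, zero_add, pow_zero, one_mul]
    rw [MvPolynomial.monomial_eq, Finsupp.prod_fintype _ _ (by simp), Fin.prod_univ_castSucc, h]
    simp
  · rw [zero_pow h.ne', zero_mul, add_zero, one_mul]
    have h1 : (MvPolynomial.monomial (s - Finsupp.single (Fin.last d) 1)) ((s (Fin.last d) : ℂ)) =
        (s (Fin.last d) : ℂ) • MvPolynomial.basisMonomials (Fin (d + 1)) ℂ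
          (s - Finsupp.single (Fin.last d) 1) := by
      rw [MvPolynomial.coe_basisMonomials, MvPolynomial.smul_monomial, smul_eq_mul, mul_one]
    have h2 : s - Finsupp.single (Fin.last d) 1 + Finsupp.single (Fin.last d) 1 = s :=
      tsub_add_cancel_of_le (by
        rw [Finsupp.single_le_iff]
        exact h)
    rw [h1, LinearMap.map_smul, antiderivLast, Module.Basis.constr_basis, h2,
      MvPolynomial.smul_monomial]
    congr 1
    have h3 : ((s (Fin.last d) - 1 : ℕ) : ℂ) = s (Fin.last d) - 1 := by
      rw [Nat.cast_sub h, Nat.cast_one]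
    have h4 : (s (Fin.last d) : ℂ) ≠ 0 := by exact_mod_cast h.ne'
    simp [h3, h4]

/-- An identity of linear maps survives tensoring with A; when ∂_m q = 0 only the value at x_m = 0
is left. -/
theorem extendVar_restrictVar {q : VPoly (d + 1) A} (hq : partialD (Fin.last d) q = 0) :
    extendVar (restrictVar q) = q := by
  have h1 : (antiderivLast d) ∘ₗ
      ((MvPolynomial.pderiv (Fin.last d) : Derivation ℂ (MvPolynomial (Fin (d + 1)) ℂ)
        (MvPolynomial (Fin (d + 1)) ℂ)) :
        MvPolynomial (Fin (d + 1)) ℂ →ₗ[ℂ] MvPolynomial (Fin (d + 1)) ℂ) +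
      (MvPolynomial.rename (Fin.castSucc : Fin d → Fin (d + 1)) :
        MvPolynomial (Fin d) ℂ →ₐ[ℂ] MvPolynomial (Fin (d + 1)) ℂ).toLinearMap ∘ₗ
      (restrictPoly d).toLinearMap = LinearMap.id := by
    refine (MvPolynomial.basisMonomials (Fin (d + 1)) ℂ).ext fun s => ?_
    rw [MvPolynomial.coe_basisMonomials]
    exact antiderivLast_pderiv_monomial s
  have h2 := congrArg (fun φ => LinearMap.rTensor A φ q) h1
  simp only [LinearMap.rTensor_add, LinearMap.rTensor_comp, LinearMap.add_apply,
    LinearMap.comp_apply, LinearMap.rTensor_id, LinearMap.id_apply] at h2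
  have h3 : LinearMap.rTensor A (antiderivLast d) (partialD (Fin.last d) q) +
    extendVar (restrictVar q) = q := h2
  rwa [hq, map_zero, zero_add] at h3

end Extend

/-! ### Branching of M_k from d + 1 to d variables -/

section Decomposition

variable {d : ℕ} {A : Type} [Ring A] [Algebra ℂ A] {e : Fin (d + 1) → A} {S : Submodule ℂ A}

/-- The Gegenbauer index `m / 2 + l - 1`, where `m = d + 1`. -/
noncomputable def gegenbauerIndex (d l : ℕ) : ℂ := ((d + 1 : ℕ) : ℂ) / 2 + l - 1

theorem two_mul_gegenbauerIndex (d l : ℕ) : 2 * gegenbauerIndex d l = d + 2 * l - 1 := by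
  rw [gegenbauerIndex]
  push_cast
  ring

/-- Here 2ν + n = d + 2l - 1 + n ≥ 1. This is where d ≥ 3 enters; it clears the denominators and
makes the Appell constants nonzero. -/
theorem two_mul_gegenbauerIndex_add_ne (hd : 3 ≤ d) (l : ℕ) {n : ℤ} (hn : -1 ≤ n) :
    2 * gegenbauerIndex d l + n ≠ 0 := by
  have h : 2 * gegenbauerIndex d l + n = ((d + 2 * l - 1 + n : ℤ) : ℂ) := by
    rw [two_mul_gegenbauerIndex]
    push_cast
    ring
  rw [h]
  exact_mod_cast (by omega : (d + 2 * l - 1 + n : ℤ) ≠ 0)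

theorem xe_mul_mem_homPoly (hS : ∀ i j, ∀ s ∈ S, e i * e j * s ∈ S) {k : ℕ}
    {q : VPoly (d + 1) A} (hq : q ∈ homPoly (d + 1) S k) : xe e * q ∈ homPoly (d + 1) S (1 + k) := by
  rw [xe_mul]
  exact Submodule.sum_mem _ fun i _ => smul_mem_homPoly (MvPolynomial.isHomogeneous_X _ _)
    (mulVal_mem_homPoly (hS _ _) hq)

theorem gegenbauerX_mem_homPoly (hS : ∀ i j, ∀ s ∈ S, e i * e j * s ∈ S) (ν : ℂ) (n : ℕ) {k : ℕ}
    {q : VPoly (d + 1) A} (hq : q ∈ homPoly (d + 1) S k) :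
    gegenbauerX e ν n q ∈ homPoly (d + 1) S (n + k) := by
  refine Submodule.add_mem _ (smul_mem_homPoly (gegenbauerHom_isHomogeneous d ν n) hq) ?_
  rw [mul_smul, C_smul_vpoly]
  refine Submodule.smul_mem _ _ ?_
  cases n with
  | zero =>
    rw [gegenbauerInt_of_neg _ _ (by simp), zero_smul]
    exact Submodule.zero_mem _
  | succ n =>
    rw [Nat.cast_succ, add_sub_cancel_right, gegenbauerInt_natCast, add_assoc]
    exact smul_mem_homPoly (gegenbauerHom_isHomogeneous d _ n) (xe_mul_mem_homPoly hS hq)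

theorem gegenbauerX_mem_monogenics (he : IsCliffordFrame e) (hd : 3 ≤ d)
    (hS : ∀ i j, ∀ s ∈ S, e i * e j * s ∈ S) (j l : ℕ) {p : VPoly d A}
    (hp : p ∈ monogenics (fun i : Fin d => e i.castSucc) S l) :
    gegenbauerX e (gegenbauerIndex d l) j (extendVar p) ∈ monogenics e S (j + l) := by
  refine ⟨gegenbauerX_mem_homPoly hS _ _ (extendVar_mem_homPoly hp.1), ?_⟩
  refine dirac_gegenbauerX he _ l (two_mul_gegenbauerIndex d l) j
    (two_mul_gegenbauerIndex_add_ne hd l (by omega)) ?_ _ (partialD_last_extendVar p) ?_ ?_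
  · have := two_mul_gegenbauerIndex_add_ne hd l (n := j - 1) (by omega)
    push_cast at this ⊢
    rwa [← add_sub_assoc] at this
  · have h : dirac (fun i : Fin d => e i.castSucc) p = 0 := hp.2
    rw [lowerDirac_extendVar, h, map_zero]
  · rw [lowerEuler_extendVar, eulerD_of_mem_homPoly hp.1, LinearMap.map_smul]

theorem partialD_last_gegenbauerX_extendVar (hd : 3 ≤ d) (l : ℕ) {n : ℤ} (hn : 0 ≤ n)
    (p : VPoly d A) :
    partialD (Fin.last d) (gegenbauerX e (gegenbauerIndex d l) n (extendVar p)) =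
      (2 * gegenbauerIndex d l + (n - 1 : ℤ)) •
        gegenbauerX e (gegenbauerIndex d l) (n - 1) (extendVar p) := by
  have h := two_mul_gegenbauerIndex_add_ne hd l (n := n - 1) (by omega)
  have h' : 2 * gegenbauerIndex d l + ((n - 1 : ℤ) : ℂ) = 2 * gegenbauerIndex d l + n - 1 := by
    push_cast
    ring
  rw [h'] at h ⊢
  exact partialD_last_gegenbauerX _ n (two_mul_gegenbauerIndex_add_ne hd l (by omega)) h _
    (partialD_last_extendVar p)

theorem partialD_mem_monogenics {k : ℕ} (i : Fin (d + 1)) {q : VPoly (d + 1) A}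
    (hq : q ∈ monogenics e S k) : partialD i q ∈ monogenics e S (k - 1) := by
  refine ⟨partialD_mem_homPoly i hq.1, ?_⟩
  have h : dirac e q = 0 := hq.2
  have h2 : dirac e (partialD i q) = partialD i (dirac e q) := by
    simp only [dirac_apply, map_sum, partialD_mulVal, partialD_comm i]
  exact h2.trans (by rw [h, map_zero])

theorem partialD_eq_zero_of_mem_homPoly_zero (i : Fin d) {q : VPoly d A}
    (hq : q ∈ homPoly d S 0) : partialD i q = 0 := by
  have h := map_mem_of_homPoly (partialD i) ⊥
    (fun f hf s hs => by
      have hC := MvPolynomial.totalDegree_eq_zero_iff_eq_C.1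
        ((MvPolynomial.totalDegree_zero_iff_isHomogeneous _).2 hf)
      rw [partialD_tmul, hC, MvPolynomial.pderiv_C, TensorProduct.zero_tmul]
      exact Submodule.zero_mem _) hq
  exact h

theorem exists_extendVar_of_partialD_last_eq_zero {k : ℕ} {q : VPoly (d + 1) A}
    (hq : q ∈ monogenics e S k) (h : partialD (Fin.last d) q = 0) :
    ∃ p ∈ monogenics (fun i : Fin d => e i.castSucc) S k, extendVar p = q := by
  refine ⟨restrictVar q, ⟨restrictVar_mem_homPoly hq.1, ?_⟩, extendVar_restrictVar h⟩
  have h2 : dirac e q = 0 := hq.2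
  rw [dirac_eq_lowerDirac, h, map_zero, add_zero, ← extendVar_restrictVar h,
    lowerDirac_extendVar] at h2
  exact extendVar_injective (h2.trans (map_zero _).symm)

/-- The branching of spherical monogenics. -/
theorem exists_gegenbauerX_decomposition (he : IsCliffordFrame e) (hd : 3 ≤ d)
    (hS : ∀ i j, ∀ s ∈ S, e i * e j * s ∈ S) (k : ℕ) {q : VPoly (d + 1) A}
    (hq : q ∈ monogenics e S k) :
    ∃ p : ℕ → VPoly d A, (∀ j ≤ k, p j ∈ monogenics (fun i : Fin d => e i.castSucc) S (k - j)) ∧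
      q = ∑ j ∈ Finset.range (k + 1),
        gegenbauerX e (gegenbauerIndex d (k - j)) j (extendVar (p j)) := by
  induction k generalizing q with
  | zero =>
    obtain ⟨p, hp, rfl⟩ := exists_extendVar_of_partialD_last_eq_zero hq
      (partialD_eq_zero_of_mem_homPoly_zero _ hq.1)
    refine ⟨fun _ => p, fun j _ => by simpa using hp, ?_⟩
    simp [gegenbauerX_zero]
  | succ k ih =>
    have hq' := partialD_mem_monogenics (Fin.last d) hq
    rw [Nat.add_sub_cancel] at hq'
    obtain ⟨p, hp, hpq⟩ := ih hq'
    -- The Appell constant of X^{(j+1)}; dividing by it makes X^{(j+1)} an antiderivative of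
    -- X^{(j)}.
    set c : ℕ → ℂ := fun j => 2 * gegenbauerIndex d (k - j) + (j : ℤ) with hc
    have hc0 : ∀ j, c j ≠ 0 := fun j => two_mul_gegenbauerIndex_add_ne hd _ (by omega)
    have hp' : ∀ j ≤ k, (c j)⁻¹ • p j ∈ monogenics (fun i : Fin d => e i.castSucc) S (k - j) :=
      fun j hj => Submodule.smul_mem _ _ (hp j hj)
    set Q := ∑ j ∈ Finset.range (k + 1), gegenbauerX e (gegenbauerIndex d (k - j)) (j + 1 : ℕ)
      (extendVar ((c j)⁻¹ • p j)) with hQ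
    have hQmem : Q ∈ monogenics e S (k + 1) := by
      refine Submodule.sum_mem _ fun j hj => ?_
      have hj' : j ≤ k := by
        have := Finset.mem_range.1 hj
        omega
      have := gegenbauerX_mem_monogenics he hd hS (j + 1) (k - j) (hp' j hj')
      rwa [show j + 1 + (k - j) = k + 1 by omega] at this
    have hQd : partialD (Fin.last d) Q = partialD (Fin.last d) q := by
      rw [hpq, hQ, map_sum]
      refine Finset.sum_congr rfl fun j _ => ?_
      rw [partialD_last_gegenbauerX_extendVar hd _ (by omega), Nat.cast_succ, add_sub_cancel_right,
        LinearMap.map_smul, gegenbauerX_C_smul, smul_smul, mul_inv_cancel₀ (hc0 j), one_smul]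
    obtain ⟨p0, hp0, hp0q⟩ := exists_extendVar_of_partialD_last_eq_zero
      (Submodule.sub_mem _ hq hQmem) (by rw [map_sub, hQd, sub_self])
    -- Integration shifts j to j + 1 while the degree (k + 1) - (j + 1) = k - j stays; the free slot
    -- j = 0 takes the remainder.
    refine ⟨fun j => Nat.casesOn j p0 fun j => (c j)⁻¹ • p j, ?_, ?_⟩
    · intro j hj
      cases j with
      | zero => exact hp0
      | succ j =>
        rw [Nat.add_sub_add_right]
        exact hp' j (by omega)
    · rw [Finset.sum_range_succ']
      simp only [Nat.add_sub_add_right, Nat.cast_zero, gegenbauerX_zero]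
      rw [← hQ]
      change q = Q + extendVar p0
      rw [hp0q]
      abel

/-- Iterating the Appell property strips X^{(j)} from p. It follows that multiplication by X^{(j)}
is injective, and that ∂_m^k sees only the component j = k. -/
theorem exists_partialD_last_pow_gegenbauerX (hd : 3 ≤ d) (l j : ℕ) :
    ∃ c : ℂ, c ≠ 0 ∧ ∀ p : VPoly d A, ((partialD (Fin.last d)) ^ j)
      (gegenbauerX e (gegenbauerIndex d l) j (extendVar p)) = c • extendVar p := by
  induction j with
  | zero => exact ⟨1, one_ne_zero, fun p => by simp [gegenbauerX_zero]⟩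
  | succ j ih =>
    obtain ⟨c, hc, h⟩ := ih
    refine ⟨(2 * gegenbauerIndex d l + (j : ℤ)) * c,
      mul_ne_zero (two_mul_gegenbauerIndex_add_ne hd l (by omega)) hc, fun p => ?_⟩
    rw [pow_succ, Module.End.mul_apply, partialD_last_gegenbauerX_extendVar hd _ (by omega),
      LinearMap.map_smul, Nat.cast_succ, add_sub_cancel_right, h, smul_smul]

theorem partialD_last_pow_gegenbauerX_eq_zero (hd : 3 ≤ d) (l : ℕ) {j k : ℕ} (hjk : j < k)
    (p : VPoly d A) : ((partialD (Fin.last d)) ^ k)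
      (gegenbauerX e (gegenbauerIndex d l) j (extendVar p)) = 0 := by
  obtain ⟨c, -, h⟩ := exists_partialD_last_pow_gegenbauerX (e := e) hd l j
  obtain ⟨i, rfl⟩ := Nat.exists_eq_add_of_lt hjk
  rw [show j + i + 1 = (i + 1) + j by omega, pow_add, Module.End.mul_apply, h,
    LinearMap.map_smul, pow_succ, Module.End.mul_apply, partialD_last_extendVar, map_zero,
    smul_zero]

theorem gegenbauerX_extendVar_injective (hd : 3 ≤ d) (l j : ℕ) {p : VPoly d A}
    (h : gegenbauerX e (gegenbauerIndex d l) j (extendVar p) = 0) : p = 0 := by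
  obtain ⟨c, hc, hp⟩ := exists_partialD_last_pow_gegenbauerX (e := e) hd l j
  have h1 := hp p
  rw [h, map_zero] at h1
  have h2 := (smul_eq_zero.1 h1.symm).resolve_left hc
  exact extendVar_injective (h2.trans (map_zero _).symm)

/-- The commutator of ∂_m with the action of e_i e_m is ∂_i, which commutes with ∂_m. -/
theorem partialD_last_pow_soAction (n : ℕ) (i : Fin d) (q : VPoly (d + 1) A) :
    ((partialD (Fin.last d)) ^ (n + 1)) (soAction e i.castSucc (Fin.last d) q) =
      soAction e i.castSucc (Fin.last d) (((partialD (Fin.last d)) ^ (n + 1)) q) +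
      ((n : ℂ) + 1) • partialD i.castSucc (((partialD (Fin.last d)) ^ n) q) := by
  have h1 : ∀ q : VPoly (d + 1) A, partialD (Fin.last d) (soAction e i.castSucc (Fin.last d) q) =
      soAction e i.castSucc (Fin.last d) (partialD (Fin.last d) q) + partialD i.castSucc q := by
    intro q
    simp only [soAction_apply, map_add, map_sub, LinearMap.map_smul, partialD_mulVal,
      partialD_smul, MvPolynomial.pderiv_X_self,
      MvPolynomial.pderiv_X_of_ne (Fin.castSucc_lt_last i).ne, partialD_comm (Fin.last d)]
    rw [one_smul, zero_smul]
    abel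
  induction n with
  | zero => simp [h1]
  | succ n ih =>
    have h2 : ∀ k, partialD (Fin.last d) (partialD i.castSucc ((partialD (Fin.last d) ^ k) q)) =
        partialD i.castSucc ((partialD (Fin.last d) ^ (k + 1)) q) := by
      intro k
      rw [partialD_comm, pow_succ', Module.End.mul_apply]
    rw [pow_succ', Module.End.mul_apply, ih, map_add, h1, LinearMap.map_smul, h2,
      Module.End.mul_apply]
    push_cast
    module

/-- A nonzero invariant space of spherical monogenics contains one which does not vanish at the
pole. -/
theorem exists_partialD_last_pow_ne_zero {k : ℕ} {U : Submodule ℂ (VPoly (d + 1) A)}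
    (hU : U ≤ monogenics e S k) (hU0 : U ≠ ⊥)
    (hinv : ∀ i : Fin d, ∀ q ∈ U, soAction e i.castSucc (Fin.last d) q ∈ U) :
    ∃ q ∈ U, ((partialD (Fin.last d)) ^ k) q ≠ 0 := by
  by_contra! h
  -- If ∂_m^{n+1} kills U, the commutator formula shows that every ∂_i kills ∂_m^n q, and so does
  -- ∂_m. This polynomial is homogeneous of degree k - n > 0 with zero gradient, hence zero by
  -- Euler's identity. Descending to n = 0 gives U = 0.
  have key : ∀ N ≤ k, ∀ q ∈ U, ((partialD (Fin.last d)) ^ (k - N)) q = 0 := by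
    intro N
    induction N with
    | zero => exact fun _ => h
    | succ N ih =>
      intro hN q hq
      obtain ⟨n, hn⟩ : ∃ n, k - N = n + 1 := ⟨k - N - 1, by omega⟩
      have ih' := ih (by omega)
      rw [hn] at ih'
      rw [show k - (N + 1) = n by omega]
      have hmem : ∀ n, ((partialD (Fin.last d)) ^ n) q ∈ homPoly (d + 1) S (k - n) := by
        intro n
        induction n with
        | zero => exact (hU hq).1
        | succ n ih =>
          rw [pow_succ', Module.End.mul_apply, ← Nat.sub_sub]
          exact partialD_mem_homPoly _ ih
      have h1 := eulerD_of_mem_homPoly (hmem n)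
      have h2 : eulerD (((partialD (Fin.last d)) ^ n) q) = 0 := by
        refine Finset.sum_eq_zero fun i _ => ?_
        refine Fin.lastCases ?_ (fun i => ?_) i
        · rw [← Module.End.mul_apply, ← pow_succ', ih' q hq, smul_zero]
        · have h3 := partialD_last_pow_soAction (e := e) n i q
          rw [ih' q hq, ih' _ (hinv i q hq), map_zero, zero_add] at h3
          have h4 : ((n : ℂ) + 1) ≠ 0 := by exact_mod_cast n.succ_ne_zero
          rw [(smul_eq_zero.1 h3.symm).resolve_left h4, smul_zero]
      rw [h2] at h1
      refine (smul_eq_zero.1 h1.symm).resolve_left ?_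
      exact_mod_cast (by omega : k - n ≠ 0)
  refine hU0 ((Submodule.eq_bot_iff _).2 fun q hq => ?_)
  simpa using key k le_rfl q hq

end Decomposition

/-! ### Transport along intertwiners; the Casimir under equivalences and inner products -/

section Transport

variable {d : ℕ} {M M' : Type*} [AddCommGroup M] [Module ℂ M] [AddCommGroup M'] [Module ℂ M']
  {T : Fin d → Fin d → Module.End ℂ M} {T' : Fin (d + 1) → Fin (d + 1) → Module.End ℂ M'}
  {φ : M →ₗ[ℂ] M'}

theorem IsGTSystem.isSoIrreducible {m r : ℕ} {T : Fin m → Fin m → Module.End ℂ M}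
    {V : Submodule ℂ M} {E : Set M} (h : IsGTSystem T r V E) : IsSoIrreducible T r V := by
  cases h with
  | base _ _ hV => exact hV
  | step _ _ _ _ hV => exact hV

theorem IsSoInvariant.map (hT : ∀ i j x, T' i.castSucc j.castSucc (φ x) = φ (T i j x))
    {r : ℕ} (hr : r ≤ d) {W : Submodule ℂ M} (h : IsSoInvariant T r W) :
    IsSoInvariant T' r (W.map φ) := by
  rintro i j hij hj _ ⟨w, hw, rfl⟩
  have hi' : i.val < d := by have : i.val < j.val := hij; omega
  have hj' : j.val < d := by omega
  exact ⟨T ⟨i, hi'⟩ ⟨j, hj'⟩ w, h ⟨i, hi'⟩ ⟨j, hj'⟩ hij hj w hw,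
    (hT ⟨i, hi'⟩ ⟨j, hj'⟩ w).symm⟩

theorem IsSoInvariant.comap (hT : ∀ i j x, T' i.castSucc j.castSucc (φ x) = φ (T i j x))
    {r : ℕ} {U : Submodule ℂ M'} (h : IsSoInvariant T' r U) :
    IsSoInvariant T r (U.comap φ) := by
  intro i j hij hj w hw
  rw [Submodule.mem_comap, ← hT]
  exact h i.castSucc j.castSucc hij hj _ hw

theorem IsSoIrreducible.map (hφ : Function.Injective φ)
    (hT : ∀ i j x, T' i.castSucc j.castSucc (φ x) = φ (T i j x))
    {r : ℕ} (hr : r ≤ d) {W : Submodule ℂ M} (h : IsSoIrreducible T r W) :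
    IsSoIrreducible T' r (W.map φ) := by
  refine ⟨h.1.map hT hr, fun h0 => h.2.1 (Submodule.map_injective_of_injective hφ
    (h0.trans (Submodule.map_bot φ).symm)), fun U hU hinv => ?_⟩
  have hUeq : (U.comap φ).map φ = U :=
    Submodule.map_comap_eq_of_le (hU.trans LinearMap.map_le_range)
  have hle : U.comap φ ≤ W := by
    rw [← Submodule.comap_map_eq_of_injective hφ W]
    exact Submodule.comap_mono hU
  rcases h.2.2 _ hle (hinv.comap hT) with h1 | h1
  · left
    rw [← hUeq, h1, Submodule.map_bot]
  · right
    rw [← hUeq, h1]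

theorem SoEquivalent.of_map (hφ : Function.Injective φ)
    (hT : ∀ i j x, T' i.castSucc j.castSucc (φ x) = φ (T i j x))
    {r : ℕ} {W W' : Submodule ℂ M} (h : SoEquivalent T' r (W.map φ) (W'.map φ)) :
    SoEquivalent T r W W' := by
  obtain ⟨ψ, hψ⟩ := h
  refine ⟨(Submodule.equivMapOfInjective φ hφ W).trans
    (ψ.trans (Submodule.equivMapOfInjective φ hφ W').symm), fun i j hij hj u v huv => ?_⟩
  have h1 : ∀ w : W'.map φ,
      φ ((Submodule.equivMapOfInjective φ hφ W').symm w : W') = (w : M') := fun w => by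
    rw [← Submodule.coe_equivMapOfInjective_apply φ hφ, LinearEquiv.apply_symm_apply]
  have h2 := hψ i.castSucc j.castSucc hij hj (Submodule.equivMapOfInjective φ hφ W u)
    (Submodule.equivMapOfInjective φ hφ W v)
    (by
      rw [Submodule.coe_equivMapOfInjective_apply, Submodule.coe_equivMapOfInjective_apply, hT,
        huv])
  apply hφ
  rw [← hT]
  simp only [LinearEquiv.trans_apply, h1, h2]

theorem IsGTSystem.map (hφ : Function.Injective φ)
    (hT : ∀ i j x, T' i.castSucc j.castSucc (φ x) = φ (T i j x))
    {r : ℕ} (hr : r ≤ d) {W : Submodule ℂ M} {E : Set M} (h : IsGTSystem T r W E) :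
    IsGTSystem T' r (W.map φ) (φ '' E) := by
  induction h with
  | base V E hV v hv hv0 hE =>
    refine .base _ _ (hV.map hφ hT hr) (φ v) (Submodule.mem_map_of_mem hv) ?_ ?_
    · exact fun h0 => hv0 (hφ (h0.trans (map_zero φ).symm))
    · rw [hE, Set.image_singleton]
  | step r hr2 V E hV N W F hW hne hind hsum hE ih =>
    refine .step r hr2 _ _ (hV.map hφ hT hr) N (fun a => (W a).map φ) (fun a => φ '' F a)
      (fun a => ih a (by omega)) (fun a b hab heq => hne a b hab (heq.of_map hφ hT))
      (LinearMap.iSupIndep_map φ hφ hind) ?_ ?_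
    · rw [← Submodule.map_iSup, hsum]
    · rw [hE, Set.image_iUnion]

/-- An equivalence intertwines the Casimir sums, so two scalars by which they act must agree. -/
theorem SoEquivalent.casimirSum_eq {ι : Type*} [Fintype ι] {m r : ℕ}
    {T : Fin m → Fin m → Module.End ℂ M} {σ : ι → Fin m} (hσ : ∀ i, (σ i).val < r) {c : ℂ}
    (hself : ∀ i x, T i i x = c • x) (hswap : ∀ i j, i ≠ j → ∀ x, T j i x = -T i j x)
    {W W' : Submodule ℂ M} (hW0 : W ≠ ⊥) (hWinv : IsSoInvariant T r W)
    (h : SoEquivalent T r W W') {a b : ℂ} (ha : ∀ w ∈ W, casimirSum T σ w = a • w)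
    (hb : ∀ w ∈ W', casimirSum T σ w = b • w) : a = b := by
  obtain ⟨ψ, hψ⟩ := h
  -- Equivalence is stated only for i < j; the diagonal and the reversed pairs of the Casimir sum
  -- are brought back to it by `hself` and `hswap`.
  have key : ∀ i j (u : W), ∃ v : W, (v : M) = T (σ i) (σ j) u ∧
      (ψ v : M) = T (σ i) (σ j) (ψ u) := by
    intro i j u
    rcases lt_trichotomy (σ i) (σ j) with hij | hij | hij
    · exact ⟨⟨_, hWinv _ _ hij (hσ j) u u.2⟩, rfl, hψ _ _ hij (hσ j) _ _ rfl⟩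
    · refine ⟨c • u, ?_, ?_⟩
      · rw [hij, hself, Submodule.coe_smul]
      · rw [hij, hself, map_smul, Submodule.coe_smul]
    · refine ⟨-⟨_, hWinv _ _ hij (hσ i) u u.2⟩, ?_, ?_⟩
      · rw [hswap _ _ hij.ne, Submodule.coe_neg]
      · rw [hswap _ _ hij.ne, map_neg, Submodule.coe_neg, hψ _ _ hij (hσ i) _ _ rfl]
  choose τ hτ hτ' using key
  obtain ⟨w, hw, hw0⟩ := Submodule.exists_mem_ne_zero_of_ne_bot hW0
  have h1 : ∑ i, ∑ j, τ i j (τ i j ⟨w, hw⟩) = a • (⟨w, hw⟩ : W) := by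
    apply Subtype.ext
    simp only [Submodule.coe_sum, hτ, Submodule.coe_smul]
    rw [← ha w hw]
    simp [casimirSum]
  have h2 : ((ψ (∑ i, ∑ j, τ i j (τ i j ⟨w, hw⟩)) : W') : M) = b • (ψ ⟨w, hw⟩ : M) := by
    rw [← hb _ (ψ ⟨w, hw⟩).2]
    simp only [map_sum, Submodule.coe_sum, hτ']
    simp [casimirSum]
  rw [h1, map_smul, Submodule.coe_smul] at h2
  have h3 : ((ψ ⟨w, hw⟩ : W') : M) ≠ 0 := by
    intro h0
    have h4 : ψ ⟨w, hw⟩ = 0 := Subtype.ext h0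
    rw [LinearEquiv.map_eq_zero_iff] at h4
    exact hw0 (congrArg Subtype.val h4)
  exact smul_left_injective ℂ h3 h2

/-- Each bivector acts skew-adjointly, so its square is self-adjoint; the diagonal terms are squares
of a real scalar. -/
theorem IsInvariantInner.casimirSum_symm {ι : Type*} [Fintype ι] {m : ℕ}
    {T : Fin m → Fin m → Module.End ℂ M} (σ : ι → Fin m) {c : ℝ}
    (hself : ∀ i x, T i i x = (c : ℂ) • x) (hswap : ∀ i j, i ≠ j → ∀ x, T j i x = -T i j x)
    {V : Submodule ℂ M} (hV : IsSoInvariant T m V) {B : M →ₗ⋆[ℂ] M →ₗ[ℂ] ℂ}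
    (hB : IsInvariantInner T V B) {u v : M} (hu : u ∈ V) (hv : v ∈ V) :
    B (casimirSum T σ u) v = B u (casimirSum T σ v) := by
  have key : ∀ i j, B (T i j (T i j u)) v = B u (T i j (T i j v)) := by
    intro i j
    have hlt : ∀ i j, i < j → B (T i j (T i j u)) v = B u (T i j (T i j v)) := by
      intro i j hij
      rw [hB.invariant i j hij _ (hV i j hij j.2 u hu) v hv,
        hB.invariant i j hij u hu _ (hV i j hij j.2 v hv), neg_neg]
    rcases lt_trichotomy i j with hij | hij | hij
    · exact hlt i j hij
    · rw [hij, hself, hself, hself, hself]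
      simp only [LinearMap.map_smulₛₗ, LinearMap.smul_apply, Complex.conj_ofReal, RingHom.id_apply]
    · have hneg : ∀ x, T i j (T i j x) = T j i (T j i x) := fun x => by
        rw [hswap j i hij.ne, hswap j i hij.ne, map_neg, neg_neg]
      rw [hneg, hneg]
      exact hlt j i hij
  simp only [casimirSum, LinearMap.sum_apply, LinearMap.comp_apply, map_sum, key]

end Transport

/-! ### The so-action on monogenics and the normalisation of X^{(j)} -/

section Branching

variable {d : ℕ} {A : Type} [Ring A] [Algebra ℂ A] {S : Submodule ℂ A}

theorem mulVal_mul_bivector {e : Fin d → A} (he : IsCliffordFrame e) (i j k : Fin d)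
    (p : VPoly d A) :
    mulVal (e k * (e i * e j)) p = mulVal (e i * e j * e k) p +
      (if k = j then (2 : ℂ) • mulVal (e i) p else 0) -
      (if k = i then (2 : ℂ) • mulVal (e j) p else 0) := by
  have h1 := he.mul_anticomm_apply k i (mulVal (e j) p)
  have h2 := congrArg (mulVal (e i)) (he.mul_anticomm_apply k j p)
  rw [map_add] at h2
  simp only [mulVal_mulVal, mul_assoc] at h1 h2 ⊢
  rw [eq_sub_of_add_eq h1, eq_sub_of_add_eq h2]
  split_ifs <;> simp only [LinearMap.map_smul, map_zero] <;> module

theorem soAction_mem_monogenics {e : Fin d → A} (he : IsCliffordFrame e)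
    (hS : ∀ i j, ∀ s ∈ S, e i * e j * s ∈ S) (i j : Fin d) {k : ℕ} {q : VPoly d A}
    (hq : q ∈ monogenics e S k) : soAction e i j q ∈ monogenics e S k := by
  have hX : ∀ i j : Fin d, (MvPolynomial.X j : MvPolynomial (Fin d) ℂ) • partialD i q ∈
      homPoly d S k := by
    intro i j
    cases k with
    | zero =>
      rw [partialD_eq_zero_of_mem_homPoly_zero i hq.1, smul_zero]
      exact Submodule.zero_mem _
    | succ k =>
      rw [add_comm]
      have h := partialD_mem_homPoly i hq.1
      rw [Nat.add_sub_cancel] at h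
      exact smul_mem_homPoly (MvPolynomial.isHomogeneous_X _ _) h
  have hD : dirac e q = 0 := hq.2
  refine ⟨?_, ?_⟩
  · rw [soAction_apply]
    exact Submodule.sub_mem _ (Submodule.add_mem _ (Submodule.smul_mem _ _
      (mulVal_mem_homPoly (hS i j) hq.1)) (hX i j)) (hX j i)
  -- The coordinates contribute e_j ∂_i - e_i ∂_j after summation over k, the spin part contributes
  -- the opposite, so the Dirac operator commutes with the action.
  · have h1 : ∀ k, mulVal (e k) (partialD k (soAction e i j q)) =
        soAction e i j (mulVal (e k) (partialD k q)) +
        (if k = j then mulVal (e j) (partialD i q) else 0) -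
        (if k = i then mulVal (e i) (partialD j q) else 0) +
        ((if k = j then mulVal (e i) (partialD j q) else 0) -
        (if k = i then mulVal (e j) (partialD i q) else 0)) := by
      intro k
      have h : (1 / 2 : ℂ) • mulVal (e k * (e i * e j)) (partialD k q) =
          (1 / 2 : ℂ) • mulVal (e i * e j * e k) (partialD k q) +
          (if k = j then mulVal (e i) (partialD k q) else 0) -
          (if k = i then mulVal (e j) (partialD k q) else 0) := by
        rw [mulVal_mul_bivector he]
        split_ifs <;> module
      simp only [soAction_apply, map_add, map_sub, LinearMap.map_smul, partialD_mulVal,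
        partialD_smul, mulVal_mulVal, mulVal_smul, MvPolynomial.pderiv_X, Pi.single_apply, h,
        partialD_comm k]
      rcases eq_or_ne k j with rfl | hj
      · rcases eq_or_ne k i with rfl | hi
        · simp only [if_true, one_smul]
          module
        · simp only [hi, hi.symm, if_true, if_false, one_smul, zero_smul]
          module
      · rcases eq_or_ne k i with rfl | hi
        · simp only [hj, hj.symm, if_true, if_false, one_smul, zero_smul]
          module
        · simp only [hi, hj, hi.symm, hj.symm, if_false, zero_smul]
          module
    have h2 : dirac e (soAction e i j q) = soAction e i j (dirac e q) := by
      rw [dirac_apply, dirac_apply, map_sum]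
      simp only [h1, Finset.sum_add_distrib, Finset.sum_sub_distrib, Finset.sum_ite_eq',
        Finset.mem_univ, if_true]
      abel
    exact h2.trans (by rw [hD, map_zero])

variable {e : Fin (d + 1) → A}

theorem ascPochhammer_eval_ne_zero {ν : ℂ} (h : ∀ n : ℕ, ν + n ≠ 0) (n : ℕ) :
    (ascPochhammer ℂ n).eval ν ≠ 0 := by
  induction n with
  | zero => simp
  | succ n ih =>
    rw [ascPochhammer_succ_right, Polynomial.eval_mul]
    refine mul_ne_zero ih ?_
    simpa using h n

/-- Only the constant term survives at 0; it is ±(ν)_s / s!. -/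
theorem gegenbauer_even_zero_ne_zero {ν : ℂ} (h : ∀ n : ℕ, ν + n ≠ 0) (s : ℕ) :
    gegenbauer ν (2 * s) 0 ≠ 0 := by
  have h1 : gegenbauer ν (2 * s) 0 = gegenbauerCoeff ν (2 * s) s := by
    rw [gegenbauer, Finset.sum_eq_single s]
    · simp
    · intro i hi his
      have h2 : 2 * s - 2 * i ≠ 0 := by
        have := Finset.mem_range.1 hi
        omega
      rw [mul_zero, zero_pow h2, mul_zero]
    · intro hs
      exact absurd (Finset.mem_range.2 (by omega)) hs
  rw [h1, gegenbauerCoeff]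
  refine div_ne_zero (mul_ne_zero (by simp) (ascPochhammer_eval_ne_zero h _)) ?_
  exact mul_ne_zero (by exact_mod_cast s.factorial_ne_zero)
    (by exact_mod_cast (Nat.factorial_ne_zero _))

theorem gegenbauerIndex_add_ne_zero (hd : 3 ≤ d) (l n : ℕ) : gegenbauerIndex d l + n ≠ 0 := by
  intro h
  refine two_mul_gegenbauerIndex_add_ne hd l (n := 2 * n) (by omega) ?_
  push_cast
  linear_combination 2 * h

theorem gegenbauerIndex_succ (d l : ℕ) : gegenbauerIndex d (l + 1) = gegenbauerIndex d l + 1 := by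
  simp only [gegenbauerIndex]
  push_cast
  ring

theorem muConst_ne_zero (hd : 3 ≤ d) (j l : ℕ) : muConst (d + 1) j l ≠ 0 := by
  have h1 : ((d + 1 : ℕ) : ℂ) / 2 + l - 1 = gegenbauerIndex d l := rfl
  have h2 : ((d + 1 : ℕ) : ℂ) / 2 + l = gegenbauerIndex d (l + 1) := by
    rw [gegenbauerIndex_succ, gegenbauerIndex]
    ring
  rw [muConst, h1, h2]
  split_ifs with h
  · obtain ⟨s, rfl⟩ := even_iff_exists_two_mul.1 h
    exact mul_ne_zero (by simp) (inv_ne_zero (gegenbauer_even_zero_ne_zero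
      (gegenbauerIndex_add_ne_zero hd l) s))
  · generalize j / 2 = s
    have h3 := two_mul_gegenbauerIndex_add_ne hd l (n := 2 * (s : ℤ) + 1) (by omega)
    have h4 := two_mul_gegenbauerIndex_add_ne hd l (n := 0) (by omega)
    rw [two_mul_gegenbauerIndex] at h3 h4
    refine mul_ne_zero (mul_ne_zero (by simp) (div_ne_zero ?_ ?_)) (inv_ne_zero
      (gegenbauer_even_zero_ne_zero (gegenbauerIndex_add_ne_zero hd (l + 1)) _))
    · convert h3 using 1
      push_cast
      ring
    · convert h4 using 1
      push_cast
      ring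

/-- With ν = m/2 + l - 1 one has m + 2l - 2 = 2ν and m + 2l + j - 2 = 2ν + j; the remaining factor μ
is nonzero, so it affects no subspace. -/
theorem exists_XPoly_mul_eq_smul (e : Fin (d + 1) → A) (hd : 3 ≤ d) (j l : ℕ) :
    ∃ c : ℂ, c ≠ 0 ∧ ∀ q : VPoly (d + 1) A,
      XPoly e j l * q = c • gegenbauerX e (gegenbauerIndex d l) j q := by
  cases j with
  | zero => exact ⟨1, one_ne_zero, fun q => by simp [XPoly, gegenbauerX_zero]⟩
  | succ j =>
    refine ⟨muConst (d + 1) (j + 1) l, muConst_ne_zero hd _ _, fun q => ?_⟩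
    have h2 : ((d + 1 : ℕ) : ℂ) / 2 + l = gegenbauerIndex d l + 1 := by
      rw [gegenbauerIndex]
      ring
    have hn : ((j + 1 : ℕ) : ℤ) - 1 = (j : ℕ) := by
      push_cast
      ring
    rw [XPoly, gegenbauerX, smul_mul_assoc, add_mul, smul_mul_assoc, mul_assoc,
      ← poly_smul_eq_mul, ← poly_smul_eq_mul, mul_smul, C_smul_vpoly, h2, hn,
      gegenbauerInt_natCast, gegenbauerInt_natCast]
    have h3 : ((d + 1 : ℕ) : ℂ) + 2 * l - 2 = 2 * gegenbauerIndex d l := by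
      rw [two_mul_gegenbauerIndex]
      push_cast
      ring
    have h4 : ((d + 1 : ℕ) : ℂ) + 2 * l + ((j + 1 : ℕ) : ℂ) - 2 =
        2 * gegenbauerIndex d l + (((j + 1 : ℕ) : ℤ) : ℂ) := by
      rw [← h3]
      push_cast
      ring
    rw [h3, h4, add_sub_cancel_right]

/-- Multiplication of polynomials in `(x_1, …, x_d)` by `X^{(j)}_l`. -/
noncomputable def XPolyMap (e : Fin (d + 1) → A) (j l : ℕ) : VPoly d A →ₗ[ℂ] VPoly (d + 1) A :=
  LinearMap.mulLeft ℂ (XPoly e j l) ∘ₗ extendVar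

theorem XPolyMap_apply (j l : ℕ) (p : VPoly d A) :
    XPolyMap e j l p = XPoly e j l * extendVar p := rfl

theorem XPolyMap_injective (hd : 3 ≤ d) (j l : ℕ) : Function.Injective (XPolyMap e j l) := by
  rw [injective_iff_map_eq_zero]
  intro p hp
  obtain ⟨c, hc, h⟩ := exists_XPoly_mul_eq_smul e hd j l
  rw [XPolyMap_apply, h] at hp
  exact gegenbauerX_extendVar_injective hd l j ((smul_eq_zero.1 hp).resolve_left hc)

theorem soAction_XPolyMap (he : IsCliffordFrame e) (hd : 3 ≤ d) (j l : ℕ) (i i' : Fin d)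
    (p : VPoly d A) :
    soAction e i.castSucc i'.castSucc (XPolyMap e j l p) =
      XPolyMap e j l (soAction (fun i : Fin d => e i.castSucc) i i' p) := by
  obtain ⟨c, -, h⟩ := exists_XPoly_mul_eq_smul e hd j l
  rw [XPolyMap_apply, XPolyMap_apply, h, h, LinearMap.map_smul, soAction_gegenbauerX he,
    soAction_extendVar]

theorem map_XPolyMap_eq (hd : 3 ≤ d) (j l : ℕ) (W : Submodule ℂ (VPoly d A)) (q : VPoly (d + 1) A) :
    q ∈ W.map (XPolyMap e j l) ↔
      ∃ p ∈ W, gegenbauerX e (gegenbauerIndex d l) j (extendVar p) = q := by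
  obtain ⟨c, hc, h⟩ := exists_XPoly_mul_eq_smul e hd j l
  constructor
  · rintro ⟨p, hp, rfl⟩
    refine ⟨c • p, W.smul_mem _ hp, ?_⟩
    rw [XPolyMap_apply, h, LinearMap.map_smul, gegenbauerX_C_smul]
  · rintro ⟨p, hp, rfl⟩
    refine ⟨c⁻¹ • p, W.smul_mem _ hp, ?_⟩
    rw [LinearMap.map_smul, XPolyMap_apply, h, smul_smul, inv_mul_cancel₀ hc, one_smul]

end Branching

/-! ### Null spinors and powers of a null coordinate -/

section NullSpinor

variable {d : ℕ} {A : Type} [Ring A] [Algebra ℂ A] {S : Submodule ℂ A}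

/-- The vector space `S` contains a spinor annihilated by the null vector `e_i - i e_j`. -/
theorem exists_null_spinor {e : Fin d → A} (he : IsCliffordFrame e)
    (hS : ∀ i j, ∀ s ∈ S, e i * e j * s ∈ S) (hS0 : S ≠ ⊥) {i j m : Fin d} (hij : i ≠ j)
    (him : i ≠ m) (hjm : j ≠ m) : ∃ f ∈ S, f ≠ 0 ∧ e i * f = Complex.I • (e j * f) := by
  -- The null vector n = e_i - i e_j has n² = 0, so it kills n e_m g. The extra factor e_m is there
  -- because S is stable only under even products.
  have hmem : ∀ g ∈ S, e i * e m * g - Complex.I • (e j * e m * g) ∈ S := fun g hg =>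
    S.sub_mem (hS _ _ g hg) (S.smul_mem _ (hS _ _ g hg))
  have hnull : ∀ g, e i * (e i * e m * g - Complex.I • (e j * e m * g)) =
      Complex.I • (e j * (e i * e m * g - Complex.I • (e j * e m * g))) := by
    intro g
    have h1 : e i * (e i * e m * g) = -(e m * g) := by
      rw [← mul_assoc, ← mul_assoc, he.sq, neg_one_mul, neg_mul]
    have h2 : e j * (e j * e m * g) = -(e m * g) := by
      rw [← mul_assoc, ← mul_assoc, he.sq, neg_one_mul, neg_mul]
    have h3 : e j * (e i * e m * g) = -(e i * (e j * e m * g)) := by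
      rw [← mul_assoc, ← mul_assoc, he.anti hij.symm, neg_mul, neg_mul, mul_assoc (e i),
        mul_assoc (e i)]
    rw [mul_sub, mul_sub, mul_smul_comm, mul_smul_comm, h1, h2, h3, smul_sub, smul_smul,
      Complex.I_mul_I]
    module
  obtain ⟨g, hg, hg0⟩ := Submodule.exists_mem_ne_zero_of_ne_bot hS0
  by_contra! h
  -- Otherwise n e_m annihilates S, hence so does n, as e_m n e_m = n. Applying this to g and to e_i
  -- e_m g gives n g = 0 and n e_i g = 0, against n e_i + e_i n = -2.
  have hzero : ∀ g ∈ S, e i * e m * g = Complex.I • (e j * e m * g) := by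
    intro g hg
    by_contra h0
    exact h _ (hmem g hg) (sub_ne_zero.2 h0) (hnull g)
  have h1 : e i * g = Complex.I • (e j * g) := by
    have hm : ∀ k, k ≠ m → e m * (e k * e m * g) = e k * g := fun k hk => by
      rw [← mul_assoc, ← mul_assoc, he.anti hk.symm, neg_mul, mul_assoc (e k), he.sq, mul_neg_one,
        neg_neg]
    rw [← hm i him, hzero g hg, mul_smul_comm, hm j hjm]
  have h2 := hzero _ (hS i m g hg)
  have hm2 : ∀ k, e k * e m * (e i * e m * g) = e k * (e i * g) := fun k => by
    have h3 : e m * (e i * e m * g) = e i * g := by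
      rw [← mul_assoc, ← mul_assoc, he.anti him.symm, neg_mul, mul_assoc (e i), he.sq, mul_neg_one,
        neg_neg]
    rw [mul_assoc, h3]
  rw [hm2, hm2, ← mul_assoc, he.sq, neg_one_mul, h1, mul_smul_comm, ← mul_assoc, he.sq,
    neg_one_mul, smul_smul, Complex.I_mul_I, neg_smul, one_smul, neg_neg] at h2
  have h3 : (2 : ℂ) • g = 0 := by
    rw [two_smul]
    nth_rewrite 1 [← h2]
    exact neg_add_cancel g
  exact hg0 ((smul_eq_zero.1 h3).resolve_left two_ne_zero)

variable {e : Fin (d + 1) → A}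

theorem pderiv_null_pow (i j k : Fin d) (l : ℕ) :
    MvPolynomial.pderiv k ((MvPolynomial.X i - MvPolynomial.C Complex.I * MvPolynomial.X j :
      MvPolynomial (Fin d) ℂ) ^ l) =
    ((if i = k then 1 else 0) - (if j = k then MvPolynomial.C Complex.I else 0)) *
      ((l : MvPolynomial (Fin d) ℂ) * (MvPolynomial.X i -
        MvPolynomial.C Complex.I * MvPolynomial.X j) ^ (l - 1)) := by
  rw [MvPolynomial.pderiv_pow, map_sub, MvPolynomial.pderiv_C_mul, MvPolynomial.pderiv_X,
    MvPolynomial.pderiv_X, Pi.single_apply, Pi.single_apply, mul_ite, mul_one, mul_zero]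
  ring

/-- The Dirac operator maps z^l f, with z = x_i - i x_j, to l z^{l-1} (e_i - i e_j) f = 0. -/
theorem null_pow_tmul_mem_monogenics {e : Fin d → A} {i j : Fin d} {f : A}
    (hf : f ∈ S) (hnull : e i * f = Complex.I • (e j * f)) (l : ℕ) :
    ((MvPolynomial.X i - MvPolynomial.C Complex.I * MvPolynomial.X j :
      MvPolynomial (Fin d) ℂ) ^ l) ⊗ₜ[ℂ] f ∈ monogenics e S l := by
  refine ⟨tmul_mem_homPoly ?_ hf, ?_⟩
  · have h1 : (MvPolynomial.X i - MvPolynomial.C Complex.I * MvPolynomial.X j :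
        MvPolynomial (Fin d) ℂ).IsHomogeneous 1 := by
      have h2 := (MvPolynomial.isHomogeneous_C (Fin d) Complex.I).mul
        (MvPolynomial.isHomogeneous_X ℂ j)
      rw [zero_add] at h2
      exact (MvPolynomial.isHomogeneous_X ℂ i).sub h2
    simpa using h1.pow l
  · change dirac e _ = 0
    rw [dirac_apply]
    set w := ((l : MvPolynomial (Fin d) ℂ) * (MvPolynomial.X i -
        MvPolynomial.C Complex.I * MvPolynomial.X j) ^ (l - 1)) with hw
    have h : ∀ k, mulVal (e k) (partialD k (((MvPolynomial.X i -
        MvPolynomial.C Complex.I * MvPolynomial.X j : MvPolynomial (Fin d) ℂ) ^ l) ⊗ₜ[ℂ] f)) =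
        (if i = k then w ⊗ₜ[ℂ] (e i * f) else 0) -
        (if j = k then w ⊗ₜ[ℂ] (Complex.I • (e j * f)) else 0) := by
      intro k
      rw [partialD_tmul, pderiv_null_pow, mulVal_tmul, ← hw, sub_mul, TensorProduct.sub_tmul]
      congr 1
      · split_ifs with h1
        · rw [one_mul, h1]
        · rw [zero_mul, TensorProduct.zero_tmul]
      · split_ifs with h1
        · rw [← MvPolynomial.smul_eq_C_mul, TensorProduct.smul_tmul, h1]
        · rw [zero_mul, TensorProduct.zero_tmul]
    simp only [h, Finset.sum_sub_distrib, Finset.sum_ite_eq, Finset.mem_univ, if_true, hnull,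
      sub_self]

theorem tmul_ne_zero_of_eval_ne_zero {g : MvPolynomial (Fin d) ℂ} {x : Fin d → ℂ}
    (hg : MvPolynomial.aeval x g ≠ (0 : ℂ)) {f : A} (hf : f ≠ 0) :
    (g ⊗ₜ[ℂ] f : VPoly d A) ≠ 0 := by
  intro h
  have h1 := congrArg (fun t => TensorProduct.lid ℂ A
    (LinearMap.rTensor A (MvPolynomial.aeval x : MvPolynomial (Fin d) ℂ →ₐ[ℂ] ℂ).toLinearMap t)) h
  simp only [LinearMap.rTensor_tmul, TensorProduct.lid_tmul, map_zero,
    AlgHom.toLinearMap_apply] at h1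
  exact (smul_ne_zero hg hf) h1

end NullSpinor

/-! ### The summands of the branching and the passage between them -/

section Main

variable {d : ℕ} {A : Type} [Ring A] [Algebra ℂ A] {S : Submodule ℂ A} {e : Fin (d + 1) → A}

/-- The summand `X^{(j)}_{k-j} M_{k-j}(R^d, S)` of `M_k(R^{d+1}, S)`. -/
noncomputable def branch (e : Fin (d + 1) → A) (S : Submodule ℂ A) (k j : ℕ) :
    Submodule ℂ (VPoly (d + 1) A) :=
  (monogenics (fun i : Fin d => e i.castSucc) S (k - j)).map (XPolyMap e j (k - j))

theorem mem_branch (hd : 3 ≤ d) {k j : ℕ} {q : VPoly (d + 1) A} :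
    q ∈ branch e S k j ↔ ∃ p ∈ monogenics (fun i : Fin d => e i.castSucc) S (k - j),
      gegenbauerX e (gegenbauerIndex d (k - j)) j (extendVar p) = q :=
  map_XPolyMap_eq hd _ _ _ _

theorem branch_le_monogenics (he : IsCliffordFrame e) (hd : 3 ≤ d)
    (hS : ∀ i j, ∀ s ∈ S, e i * e j * s ∈ S) {k j : ℕ} (hj : j ≤ k) :
    branch e S k j ≤ monogenics e S k := by
  intro q hq
  obtain ⟨p, hp, rfl⟩ := (mem_branch hd).1 hq
  have h := gegenbauerX_mem_monogenics he hd hS j (k - j) hp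
  rwa [Nat.add_sub_cancel' hj] at h

theorem casimirSum_branch (he : IsCliffordFrame e) (hd : 3 ≤ d) {k j : ℕ}
    {q : VPoly (d + 1) A} (hq : q ∈ branch e S k j) :
    casimirSum (soAction e) (Fin.castSucc : Fin d → Fin (d + 1)) q =
      ((casimirScalar d (k - j) : ℝ) : ℂ) • q := by
  obtain ⟨p, hp, rfl⟩ := hq
  have h := casimirSum_monogenics he.castSucc hp
  rw [← LinearMap.map_smul, ← h]
  simp only [casimirSum, LinearMap.sum_apply, LinearMap.comp_apply, map_sum,
    soAction_XPolyMap he hd, id]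

theorem iSup_branch (he : IsCliffordFrame e) (hd : 3 ≤ d)
    (hS : ∀ i j, ∀ s ∈ S, e i * e j * s ∈ S) (k : ℕ) :
    ⨆ a : Fin (k + 1), branch e S k a = monogenics e S k := by
  refine le_antisymm (iSup_le fun a => branch_le_monogenics he hd hS (by omega)) fun q hq => ?_
  obtain ⟨p, hp, rfl⟩ := exists_gegenbauerX_decomposition he hd hS k hq
  refine Submodule.sum_mem _ fun j hj => ?_
  have hj' := Finset.mem_range.1 hj
  exact Submodule.mem_iSup_of_mem (⟨j, hj'⟩ : Fin (k + 1))
    ((mem_branch hd).2 ⟨p j, hp j (by omega), rfl⟩)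

theorem casimirScalar_sub_injective (hd : 3 ≤ d) (k : ℕ) :
    Function.Injective fun a : Fin (k + 1) => ((casimirScalar d (k - a) : ℝ) : ℂ) := by
  intro a b h
  have h1 := casimirScalar_injective (by omega) (Complex.ofReal_injective h)
  exact Fin.ext (by omega)

/-- The summands lie in eigenspaces of the so(d)-Casimir for distinct eigenvalues. -/
theorem iSupIndep_branch (he : IsCliffordFrame e) (hd : 3 ≤ d) (k : ℕ) :
    iSupIndep fun a : Fin (k + 1) => branch e S k a :=
  ((Module.End.eigenspaces_iSupIndep (casimirSum (soAction e)
    (Fin.castSucc : Fin d → Fin (d + 1)))).comp (casimirScalar_sub_injective hd k)).mono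
    fun _ _ hq => Module.End.mem_eigenspace_iff.2 (casimirSum_branch he hd hq)

theorem branch_le_of_mem {k j : ℕ} (hirr : IsSoIrreducible (soAction e) d (branch e S k j))
    {U : Submodule ℂ (VPoly (d + 1) A)} (hU : IsSoInvariant (soAction e) (d + 1) U)
    {q : VPoly (d + 1) A} (hq : q ∈ U) (hqb : q ∈ branch e S k j) (hq0 : q ≠ 0) :
    branch e S k j ≤ U := by
  rcases hirr.2.2 (U ⊓ branch e S k j) inf_le_right (fun i i' hii hi w hw =>
    ⟨hU i i' hii (by omega) w hw.1, hirr.1 i i' hii hi w hw.2⟩) with h | h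
  · have : q ∈ U ⊓ branch e S k j := ⟨hq, hqb⟩
    rw [h] at this
    exact absurd this hq0
  · rw [← h]
    exact inf_le_left

theorem IsSoInvariant.forall_mem (he : IsCliffordFrame e) {U : Submodule ℂ (VPoly (d + 1) A)}
    (hU : IsSoInvariant (soAction e) (d + 1) U) (i j : Fin (d + 1)) {q : VPoly (d + 1) A}
    (hq : q ∈ U) : soAction e i j q ∈ U := by
  rcases lt_trichotomy i j with h | h | h
  · exact hU i j h j.2 q hq
  · rw [h, soAction_self he]
    exact U.smul_mem _ hq
  · rw [soAction_swap he h.ne]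
    exact U.neg_mem (hU j i h i.2 q hq)

/-- One vector of the summand j inside U suffices, as that summand is irreducible; the raising
operator supplies it from z^l f in the summand j + 1. -/
theorem branch_le_of_branch_succ_le (he : IsCliffordFrame e) (hd : 3 ≤ d)
    (hS : ∀ i j, ∀ s ∈ S, e i * e j * s ∈ S) (hS0 : S ≠ ⊥) {k j : ℕ} (hj : j + 1 ≤ k)
    (hirr : IsSoIrreducible (soAction e) d (branch e S k j))
    {U : Submodule ℂ (VPoly (d + 1) A)} (hU : IsSoInvariant (soAction e) (d + 1) U)
    (h : branch e S k (j + 1) ≤ U) : branch e S k j ≤ U := by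
  set i0 : Fin d := ⟨0, by omega⟩ with hi0
  set i1 : Fin d := ⟨1, by omega⟩ with hi1
  have h01 : i0 ≠ i1 := by simp [hi0, hi1]
  obtain ⟨f, hf, hf0, hnull⟩ := exists_null_spinor he hS hS0 (i := i0.castSucc) (j := i1.castSucc)
    (m := Fin.last d) (by simpa using h01) (Fin.castSucc_lt_last _).ne (Fin.castSucc_lt_last _).ne
  set l := k - (j + 1) with hl
  have hl' : k - j = l + 1 := by omega
  set z : MvPolynomial (Fin d) ℂ :=
    MvPolynomial.X i0 - MvPolynomial.C Complex.I * MvPolynomial.X i1 with hz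
  have hzr : MvPolynomial.rename Fin.castSucc z = MvPolynomial.X i0.castSucc -
      MvPolynomial.C Complex.I * MvPolynomial.X i1.castSucc := by
    rw [hz, map_sub, map_mul, MvPolynomial.rename_X, MvPolynomial.rename_X, MvPolynomial.rename_C]
  have hp : ∀ l, (z ^ l) ⊗ₜ[ℂ] f ∈ monogenics (fun i : Fin d => e i.castSucc) S l := fun l =>
    null_pow_tmul_mem_monogenics (e := fun i : Fin d => e i.castSucc) (i := i0) (j := i1) hf hnull l
  have h1 : gegenbauerX e (gegenbauerIndex d l) (j + 1 : ℕ) (extendVar ((z ^ l) ⊗ₜ[ℂ] f)) ∈ U :=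
    h ((mem_branch hd).2 ⟨_, hp l, rfl⟩)
  have h2 := raising_gegenbauerX he (gegenbauerIndex d l) (j + 1 : ℕ)
    (two_mul_gegenbauerIndex_add_ne hd l (by omega))
    (by
      have := two_mul_gegenbauerIndex_add_ne hd l (n := j) (by omega)
      push_cast at this ⊢
      rwa [add_sub_assoc, add_sub_cancel_right])
    (by
      have := two_mul_gegenbauerIndex_add_ne hd l (n := j + 2) (by omega)
      push_cast at this ⊢
      rwa [add_assoc, add_assoc, one_add_one_eq_two]) i0 i1
    (extendVar ((z ^ l) ⊗ₜ[ℂ] f)) (partialD_last_extendVar _)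
    (by
      rw [partialD_castSucc_extendVar, partialD_castSucc_extendVar, ← LinearMap.map_smul,
        partialD_tmul, partialD_tmul, hz, pderiv_null_pow, pderiv_null_pow, if_pos rfl, if_pos rfl,
        if_neg h01, if_neg h01.symm, TensorProduct.smul_tmul', MvPolynomial.smul_eq_C_mul,
        ← hz]
      congr 2
      have hII : (MvPolynomial.C Complex.I * MvPolynomial.C Complex.I :
          MvPolynomial (Fin d) ℂ) = -1 := by
        rw [← map_mul, Complex.I_mul_I, map_neg, map_one]
      linear_combination ((l : MvPolynomial (Fin d) ℂ) * z ^ (l - 1)) * hII)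
    (by
      have h5 : ∀ i : Fin d, e i.castSucc * e (Fin.last d) * f =
          -(e (Fin.last d) * (e i.castSucc * f)) := fun i => by
        rw [he.anti (Fin.castSucc_lt_last i).ne, neg_mul, mul_assoc]
      rw [extendVar_tmul, mulVal_tmul, mulVal_tmul, h5, h5, hnull, mul_smul_comm, ← smul_neg,
        TensorProduct.tmul_smul])
  rw [← hzr, ← extendVar_smul, poly_smul_tmul, ← pow_succ', ← gegenbauerIndex_succ, ← hl',
    show ((j + 1 : ℕ) : ℤ) - 1 = (j : ℕ) by push_cast; ring] at h2
  have h3 := U.sub_mem (hU.forall_mem he i0.castSucc (Fin.last d) h1)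
    (U.smul_mem Complex.I (hU.forall_mem he i1.castSucc (Fin.last d) h1))
  rw [h2] at h3
  set c := -(2 * gegenbauerIndex d l * (2 * gegenbauerIndex d l + ((j + 1 : ℕ) : ℤ) + 1) /
    (2 * gegenbauerIndex d l + ((j + 1 : ℕ) : ℤ))) with hc
  have hc0 : c ≠ 0 := by
    refine neg_ne_zero.2 (div_ne_zero (mul_ne_zero ?_ ?_)
      (two_mul_gegenbauerIndex_add_ne hd l (by omega)))
    · simpa using two_mul_gegenbauerIndex_add_ne hd l (n := 0) (by omega)
    · have := two_mul_gegenbauerIndex_add_ne hd l (n := ((j + 1 : ℕ) : ℤ) + 1) (by omega)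
      rwa [Int.cast_add, Int.cast_one, ← add_assoc] at this
  have hmem := hp (l + 1)
  rw [← hl'] at hmem
  refine branch_le_of_mem hirr hU h3 ((branch e S k j).smul_mem _
    ((mem_branch hd).2 ⟨_, hmem, rfl⟩)) ?_
  intro h0
  have h4 := gegenbauerX_extendVar_injective hd _ j ((smul_eq_zero.1 h0).resolve_left hc0)
  -- At the first unit vector z takes the value 1.
  refine tmul_ne_zero_of_eval_ne_zero (x := Pi.single i0 1) ?_ hf0 h4
  rw [hz]
  simp [h01.symm]

end Main

/-! ### Irreducibility and the Gelfand–Tsetlin basis -/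

section Branching

variable {d : ℕ} {A : Type} [Ring A] [Algebra ℂ A] {S : Submodule ℂ A} {e : Fin (d + 1) → A}

/-- A nonzero invariant space of spherical monogenics meets the summand `X^{(k)}_0 M_0(R^d, S)`. -/
theorem exists_mem_branch_ne_zero (he : IsCliffordFrame e) (hd : 3 ≤ d)
    (hS : ∀ i j, ∀ s ∈ S, e i * e j * s ∈ S) {k : ℕ}
    {U : Submodule ℂ (VPoly (d + 1) A)} (hU : IsSoInvariant (soAction e) (d + 1) U) (hU0 : U ≠ ⊥)
    (hUle : U ≤ monogenics e S k) : ∃ q ∈ U, q ∈ branch e S k k ∧ q ≠ 0 := by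
  obtain ⟨q, hq, hq0⟩ := exists_partialD_last_pow_ne_zero hUle hU0
    (fun i q hq => hU.forall_mem he i.castSucc (Fin.last d) hq)
  -- The components are removed one by one, from j = 0 up to j = k - 1, without ever losing the
  -- component j = k.
  have key : ∀ N ≤ k, ∃ b : ℕ → VPoly (d + 1) A, (∀ j ≤ k, b j ∈ branch e S k j) ∧
      ∑ j ∈ Finset.Ico N (k + 1), b j ∈ U ∧ b k ≠ 0 := by
    intro N
    induction N with
    | zero =>
      intro _
      obtain ⟨p, hp, hpq⟩ := exists_gegenbauerX_decomposition he hd hS k (hUle hq)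
      refine ⟨fun j => gegenbauerX e (gegenbauerIndex d (k - j)) j (extendVar (p j)),
        fun j hj => (mem_branch hd).2 ⟨p j, hp j hj, rfl⟩, ?_, fun h0 => hq0 ?_⟩
      · rwa [← Finset.range_eq_Ico, ← hpq]
      · rw [hpq, Finset.sum_range_succ]
        dsimp only at h0
        rw [h0, add_zero, map_sum]
        exact Finset.sum_eq_zero fun j hj =>
          partialD_last_pow_gegenbauerX_eq_zero hd _ (Finset.mem_range.1 hj) _
    | succ N ih =>
      intro hN
      obtain ⟨b, hb, hbU, hb0⟩ := ih (by omega)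
      set κ : ℕ → ℂ := fun j => ((casimirScalar d (k - j) : ℝ) : ℂ) with hκ
      have hCU : casimirSum (soAction e) (Fin.castSucc : Fin d → Fin (d + 1))
          (∑ j ∈ Finset.Ico N (k + 1), b j) ∈ U := by
        simp only [casimirSum, LinearMap.sum_apply, LinearMap.comp_apply]
        exact U.sum_mem fun i _ => U.sum_mem fun j _ =>
          hU.forall_mem he _ _ (hU.forall_mem he _ _ hbU)
      have hC : casimirSum (soAction e) (Fin.castSucc : Fin d → Fin (d + 1))
          (∑ j ∈ Finset.Ico N (k + 1), b j) = ∑ j ∈ Finset.Ico N (k + 1), κ j • b j := by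
        rw [map_sum]
        refine Finset.sum_congr rfl fun j hj => casimirSum_branch he hd (hb j ?_)
        have := Finset.mem_Ico.1 hj
        omega
      -- Casimir minus κ_N preserves U and kills the component N; the component k survives because
      -- κ_k ≠ κ_N.
      refine ⟨fun j => (κ j - κ N) • b j, fun j hj => Submodule.smul_mem _ _ (hb j hj), ?_,
        smul_ne_zero ?_ hb0⟩
      · have h1 := U.sub_mem hCU (U.smul_mem (κ N) hbU)
        rw [hC, Finset.smul_sum, ← Finset.sum_sub_distrib] at h1
        have h2 : ∀ j, κ j • b j - κ N • b j = (κ j - κ N) • b j := fun j => by module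
        simp only [h2] at h1
        rw [Finset.sum_eq_sum_Ico_succ_bot (by omega), sub_self] at h1
        have h3 : (0 : ℂ) • b N = 0 := zero_smul _ _
        rwa [h3, zero_add] at h1
      · rw [sub_ne_zero]
        intro h
        have h1 := @casimirScalar_sub_injective d hd k ⟨k, by omega⟩ ⟨N, by omega⟩ h
        simp only [Fin.mk.injEq] at h1
        omega
  obtain ⟨b, hb, hbU, hb0⟩ := key k le_rfl
  rw [Nat.Ico_succ_singleton, Finset.sum_singleton] at hbU
  exact ⟨b k, hbU, hb k le_rfl, hb0⟩

variable {k : ℕ}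

theorem isSoIrreducible_branch (he : IsCliffordFrame e) (hd : 3 ≤ d) {j : ℕ}
    (h : IsSoIrreducible (soAction fun i : Fin d => e i.castSucc) d
      (monogenics (fun i : Fin d => e i.castSucc) S (k - j))) :
    IsSoIrreducible (soAction e) d (branch e S k j) :=
  h.map (XPolyMap_injective hd _ _) (soAction_XPolyMap he hd _ _) le_rfl

/-- A nonzero invariant U meets the summand j = k, hence contains it by irreducibility, and then
contains the summands k - 1, …, 0 in turn. -/
theorem isSoIrreducible_monogenics (he : IsCliffordFrame e) (hd : 3 ≤ d)
    (hS : ∀ i j, ∀ s ∈ S, e i * e j * s ∈ S) (hS0 : S ≠ ⊥)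
    (hirr : ∀ j ≤ k, IsSoIrreducible (soAction e) d (branch e S k j)) :
    IsSoIrreducible (soAction e) (d + 1) (monogenics e S k) := by
  refine ⟨fun i j _ _ q hq => soAction_mem_monogenics he hS i j hq, fun h0 => ?_,
    fun U hUle hU => ?_⟩
  · refine (hirr k le_rfl).2.1 (le_bot_iff.1 ?_)
    rw [← h0]
    exact branch_le_monogenics he hd hS le_rfl
  · refine or_iff_not_imp_left.2 fun hU0 => le_antisymm hUle ?_
    obtain ⟨q, hq, hqb, hq0⟩ := exists_mem_branch_ne_zero he hd hS hU hU0 hUle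
    have key : ∀ N ≤ k, branch e S k (k - N) ≤ U := by
      intro N
      induction N with
      | zero => exact fun _ => branch_le_of_mem (hirr k le_rfl) hU hq hqb hq0
      | succ N ih =>
        intro hN
        refine branch_le_of_branch_succ_le he hd hS hS0 (by omega) (hirr _ (by omega)) hU ?_
        rw [show k - (N + 1) + 1 = k - N by omega]
        exact ih (by omega)
    rw [← iSup_branch he hd hS k]
    refine iSup_le fun a => ?_
    have := key (k - a) (by omega)
    rwa [show k - (k - (a : ℕ)) = a by omega] at this

/-- The Gelfand-Tsetlin bases of the spherical monogenics in `d + 1` variables are obtained from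
those in `d` variables by multiplication with the polynomials `X^{(j)}`. -/
theorem isGTBasis_monogenics (he : IsCliffordFrame e) (hd : 3 ≤ d)
    (hS : ∀ i j, ∀ s ∈ S, e i * e j * s ∈ S) (hS0 : S ≠ ⊥) {B : ℕ → Set (VPoly d A)}
    (hB : ∀ j ≤ k, IsGTBasis (soAction fun i : Fin d => e i.castSucc)
      (monogenics (fun i : Fin d => e i.castSucc) S j) (B j)) :
    IsGTBasis (soAction e) (monogenics e S k)
      (⋃ j ∈ Finset.range (k + 1), (fun p => XPoly e j (k - j) * extendVar p) '' B (k - j)) := by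
  have hE : (⋃ j ∈ Finset.range (k + 1),
      (fun p => XPoly e j (k - j) * extendVar p) '' B (k - j)) =
      ⋃ a : Fin (k + 1), XPolyMap e a (k - a) '' B (k - a) := by
    ext q
    simp only [Set.mem_iUnion, Finset.mem_range]
    exact ⟨fun ⟨j, hj, h⟩ => ⟨⟨j, hj⟩, h⟩, fun ⟨a, h⟩ => ⟨a, a.2, h⟩⟩
  have hirr : ∀ j ≤ k, IsSoIrreducible (soAction e) d (branch e S k j) := fun j _ =>
    isSoIrreducible_branch he hd (hB (k - j) (Nat.sub_le _ _)).system.isSoIrreducible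
  have hV := isSoIrreducible_monogenics he hd hS hS0 hirr
  have hself : ∀ i x, soAction e i i x = (((-(1 / 2) : ℝ)) : ℂ) • x := fun i x => by
    rw [soAction_self he]
    norm_num
  have hswap : ∀ i j, i ≠ j → ∀ x, soAction e j i x = -soAction e i j x :=
    fun i j hij x => soAction_swap he hij x
  have hspan : ∀ a : Fin (k + 1), Submodule.span ℂ (XPolyMap e a (k - a) '' B (k - a)) =
      branch e S k a := fun a => by
    rw [← Submodule.map_span, (hB _ (Nat.sub_le _ _)).span_eq, branch]
  have hmem : ∀ a : Fin (k + 1), ∀ u ∈ XPolyMap e a (k - a) '' B (k - a), u ∈ branch e S k a :=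
    fun a u hu => hspan a ▸ Submodule.subset_span hu
  have hle : ∀ a : Fin (k + 1), branch e S k a ≤ monogenics e S k := fun a =>
    branch_le_monogenics he hd hS (by omega)
  rw [hE]
  refine ⟨?_, ?_, ?_, ?_⟩
  · refine .step d (by omega) _ _ hV (k + 1) (fun a => branch e S k a) _ (fun a => ?_)
      (fun a b hab h => hab ?_) (iSupIndep_branch he hd k) (iSup_branch he hd hS k) rfl
    · exact (hB _ (Nat.sub_le _ _)).system.map (XPolyMap_injective hd _ _)
        (soAction_XPolyMap he hd _ _) le_rfl
    · exact casimirScalar_sub_injective hd k (h.casimirSum_eq (σ := Fin.castSucc) (fun i => i.2)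
        hself hswap (hirr a (by omega)).2.1 (hirr a (by omega)).1
        (fun w => casimirSum_branch he hd) (fun w => casimirSum_branch he hd))
  · refine linearIndepOn_id_iUnion_finite (fun a => ?_) (fun a t _ hat => ?_)
    · refine LinearIndepOn.id_image ?_
      exact (hB _ (Nat.sub_le _ _)).linearIndep.map_injOn _ (XPolyMap_injective hd _ _).injOn
    · rw [hspan]
      simp only [hspan]
      exact (iSupIndep_branch he hd k).disjoint_biSup hat
  · rw [Submodule.span_iUnion]
    simp only [hspan]
    exact iSup_branch he hd hS k
  · intro G hG u hu v hv huv
    obtain ⟨a, hu⟩ := Set.mem_iUnion.1 hu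
    obtain ⟨b, hv⟩ := Set.mem_iUnion.1 hv
    rcases eq_or_ne a b with rfl | hab
    · obtain ⟨p, hp, rfl⟩ := hu
      obtain ⟨p', hp', rfl⟩ := hv
      set Φ := XPolyMap e a (k - a)
      -- Within one summand, the inner product pulled back along Φ is so(d)-invariant on
      -- M_{k-a}(R^d).
      refine (hB (k - a) (Nat.sub_le _ _)).orthogonal ((G.comp Φ).compl₂ Φ) ?_ p hp p' hp'
        (fun h => huv (congrArg Φ h))
      have hΦ : ∀ p ∈ monogenics (fun i : Fin d => e i.castSucc) S (k - a),
          Φ p ∈ monogenics e S k := fun p hp => hle a (Submodule.mem_map_of_mem hp)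
      refine ⟨fun p hp p' hp' => hG.conj_symm _ (hΦ p hp) _ (hΦ p' hp'), fun p hp hp0 =>
        hG.pos _ (hΦ p hp) ?_, fun i j hij p hp p' hp' => ?_⟩
      · exact fun h0 => hp0 (XPolyMap_injective hd _ _ (h0.trans (map_zero Φ).symm))
      · change G (Φ _) (Φ _) = -G (Φ _) (Φ _)
        rw [← soAction_XPolyMap he hd, ← soAction_XPolyMap he hd]
        exact hG.invariant _ _ hij _ (hΦ p hp) _ (hΦ p' hp')
    -- Different summands: eigenvectors of a self-adjoint operator for distinct real eigenvalues are
    -- orthogonal.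
    · have h1 := hG.casimirSum_symm Fin.castSucc hself hswap hV.1 (hle a (hmem a u hu))
        (hle b (hmem b v hv))
      rw [casimirSum_branch he hd (hmem a u hu), casimirSum_branch he hd (hmem b v hv)] at h1
      simp only [LinearMap.map_smulₛₗ, LinearMap.smul_apply, Complex.conj_ofReal, RingHom.id_apply,
        smul_eq_mul] at h1
      by_contra h0
      exact hab (casimirScalar_sub_injective hd k (mul_right_cancel₀ h0 h1))

theorem monogenics_bot (e : Fin d → A) (k : ℕ) : monogenics e (⊥ : Submodule ℂ A) k = ⊥ := by
  refine (Submodule.eq_bot_iff _).2 fun q hq => ?_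
  refine map_mem_of_homPoly LinearMap.id ⊥ (fun f hf s hs => ?_) hq.1
  rw [(Submodule.mem_bot ℂ).1 hs, TensorProduct.tmul_zero]
  exact Submodule.zero_mem _

end Branching

/-! ### The generators of the Clifford algebra and Spin(m) -/

section Spinor

theorem isCliffordFrame_gen (m : ℕ) : IsCliffordFrame (gen : Fin m → Cl m) := by
  intro i j
  have h : QuadraticMap.polar (negSq m) (Pi.single i 1) (Pi.single j 1) =
      if i = j then (-2 : ℂ) else 0 := by
    have h1 : QuadraticMap.polar (negSq m) (Pi.single i 1) (Pi.single j 1) =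
        ∑ l, -2 * ((Pi.single i (1 : ℂ) : Fin m → ℂ) l * (Pi.single j (1 : ℂ) : Fin m → ℂ) l) := by
      simp only [QuadraticMap.polar, QuadraticMap.weightedSumSquares_apply, Pi.add_apply,
        smul_eq_mul, ← Finset.sum_sub_distrib]
      exact Finset.sum_congr rfl fun l _ => by ring
    rw [h1, Finset.sum_eq_single i]
    · simp [Pi.single_apply]
    · intro l _ hl
      simp [Pi.single_eq_of_ne hl]
    · simp
  rw [gen, gen, CliffordAlgebra.ι_mul_ι_add_swap, h]
  split_ifs
  · rw [map_neg, map_ofNat]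
  · rw [map_zero]

theorem realVec_single {m : ℕ} (i : Fin m) : realVec (Pi.single i 1) = gen i := by
  rw [realVec, Finset.sum_eq_single i]
  · simp
  · intro j _ hj
    simp [Pi.single_eq_of_ne hj]
  · simp

/-- The products e_i e_j belong to Spin(m) itself, so invariance of S under the group gives
invariance under bivectors without differentiation. -/
theorem gen_mul_gen_mem_spin {m : ℕ} (i j : Fin m) : gen i * gen j ∈ spin m := by
  have h : ∀ i : Fin m, ∑ l, (Pi.single i (1 : ℝ) : Fin m → ℝ) l ^ 2 = 1 := fun i => by
    simp [Pi.single_apply, ite_pow]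
  exact Submonoid.subset_closure ⟨_, _, h i, h j, by rw [realVec_single, realVec_single]⟩

end Spinor

theorem corollary1 (n d : ℕ) (hn : 2 ≤ n) (hd : d + 1 = 2 * n)
    (S : Submodule ℂ (Cl (d + 1))) (hS : IsBasicSpinor S) (k : ℕ)
    (B : ℕ → Set (VPoly d (Cl (d + 1))))
    (hB : ∀ j ≤ k,
      IsGTBasis (soAction (fun i : Fin d => (gen i.castSucc : Cl (d + 1))))
        (monogenics (fun i : Fin d => (gen i.castSucc : Cl (d + 1))) S j) (B j)) :
    IsGTBasis (soAction (gen : Fin (d + 1) → Cl (d + 1)))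
      (monogenics (gen : Fin (d + 1) → Cl (d + 1)) S k)
      (⋃ j ∈ Finset.range (k + 1),
        (fun p => XPoly (gen : Fin (d + 1) → Cl (d + 1)) j (k - j) * extendVar p) '' B (k - j)) := by
  refine isGTBasis_monogenics (isCliffordFrame_gen _) (by omega)
    (fun i j s hs => hS.1 _ (gen_mul_gen_mem_spin i j) s hs) ?_ hB
  -- S ≠ 0 because M_0(R^d, S) has a GT basis, hence is irreducible and in particular nonzero.
  rintro rfl
  exact (hB 0 (Nat.zero_le k)).system.isSoIrreducible.2.1 (monogenics_bot _ _)
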